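/- Fix an algebraic theory $\mathbf{T}$ of types, i.e. a small category with finite products. A \emph{schema} $S$ is a small category $S_e$ of entities together with an algebraic profunctor of observables $S_o\colon S_e^{op}\times\mathbf T\to\mathbf{Set}$ (that is, $S_o(e,-)$ preserves finite products for every $e$). Its \emph{collage} $\tilde S$ is the category whose objects are the entities and the types, whose morphisms between entities and between types are those of $S_e$ and $\mathbf T$, with $\tilde S(e,\tau)=S_o(e,\tau)$, and with no morphisms from types to entities. A \emph{schema mapping} $F\colon R\to S$ is a functor $R_e\to S_e$ together with a natural transformation $R_o\Rightarrow S_o(F-,-)$; it induces a functor $\tilde F\colon\tilde R\to\tilde S$. An \emph{$S$-instance} is a functor $\tilde S\to\mathbf{Set}$ whose restriction to $\mathbf T$ preserves finite products; $S\text{-}\mathbf{Inst}$ is the full subcategory of functors of this kind, $\mathbf y\colon\tilde S^{op}\to S\text{-}\mathbf{Inst}$ is the Yoneda embedding, and $\Delta_F\colon S\text{-}\mathbf{Inst}\to R\text{-}\mathbf{Inst}$ is restriction along $\tilde F$. A \emph{bimodule} $M\colon R\to S$ is a functor $M\colon\tilde R^{op}\to S\text{-}\mathbf{Inst}$ together with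 an isomorphism $M(\tau)\cong\mathbf y(\tau)$ natural in $\tau\in\mathbf T$, through which $M(\tau)$ and $\mathbf y(\tau)$ are identified; a morphism in $\mathrm{Bimod}(R,S)$ is a natural transformation which is the identity on types under these identifications. For a bimodule $M\colon R\to S$ let $\Lambda_M=\mathrm{Lan}_{\mathbf y}M\colon R\text{-}\mathbf{Inst}\to S\text{-}\mathbf{Inst}$ and $\Gamma_M(J)=S\text{-}\mathbf{Inst}(M(-),J)$; then $\Lambda_M\dashv\Gamma_M$. Schemas, schema mappings and bimodules form an equipment $\mathbb{D}\mathbf{ata}$: the objects are schemas, the vertical morphisms are schema mappings, the horizontal morphisms are bimodules, a 2-cell with top $M$, bottom $M'$, left side $F$ and right side $G$ is a natural transformation $M\to\Delta_G\circ M'\circ\tilde F^{op}$ which is the identity on types, the horizontal composite is $M\odot N=\Lambda_N\circ M$, the units are the Yoneda embeddings, and the restriction of $N$ along $F$ and $G$ is $\Delta_G\circ N\circ\tilde F^{op}$. A right hom of $N\colon S\to U$ and $P\colon R\to U$ is a bimodule $H\colon R\to S$ with a 2-cell $\varepsilon\colon H\odot N\Rightarrow P$ with identity sides such that, for every schema mapping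 $F\colon X\to R$ and bimodule $M\colon X\to S$, every 2-cell $M\odot N\Rightarrow P$ with left side $F$ and right side the identity factors uniquely as $\varepsilon$ after $\theta'\odot\mathrm{id}_N$ for a 2-cell $\theta'\colon M\Rightarrow H$ with left side $F$ and right side the identity. An equipment is right closed if all right homs exist. \textbf{Proposition.} The equipment $\mathbb{D}\mathbf{ata}$ is right closed. For bimodules $N\colon S\to U$ and $P\colon R\to U$ the right hom $N\rhd P\colon R\to S$ is $\Gamma_N\circ P$ on entities, $(N\rhd P)(e)=\Gamma_N(P(e))$, and $(N\rhd P)(\tau)=\mathbf y(\tau)$ on types. In detail, the isomorphisms $N(\tau)\cong\mathbf y(\tau)\cong P(\tau)$ are elements of $\Gamma_N(P(\tau))$ of type $\tau$, and hence give morphisms $\iota_\tau\colon\mathbf y(\tau)\to\Gamma_N(P(\tau))$; an observable $x\colon e\to\tau$ acts on $N\rhd P$ as $\mathbf y(\tau)\xrightarrow{\iota_\tau}\Gamma_N(P(\tau))\xrightarrow{\Gamma_N(P(x))}\Gamma_N(P(e))$. Together with identities on entities the $\iota_\tau$ form a natural transformation $\iota\colon N\rhd P\to\Gamma_N\circ P$,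 each component of which is a bijection on the elements at every type. For all bimodules $M\colon R\to S$, $N\colon S\to U$ and $P\colon R\to U$ there is a bijection $$\Phi\colon\mathrm{Bimod}(R,U)(M\odot N,P)\;\cong\;\mathrm{Bimod}(R,S)(M,N\rhd P),$$ natural in $M$, $N$ and $P$, obtained from the adjunction $\Lambda_N\dashv\Gamma_N$: for every $\kappa\colon M\odot N\to P$ the composite $\iota\circ\Phi(\kappa)\colon M\to\Gamma_N\circ P$ is, at each object of $\tilde R$, the transpose of the corresponding component of $\kappa\colon\Lambda_N\circ M\to P$. The morphism $\Phi^{-1}(\mathrm{id})\colon(N\rhd P)\odot N\to P$ is the 2-cell $\varepsilon$ which exhibits $N\rhd P$ as the right hom. -/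

import Mathlib

open CategoryTheory CategoryTheory.Limits Opposite

universe u v₁ v₂ u₁ u₂

noncomputable section

namespace AlgData

variable {T : Type u} [SmallCategory T]

/-- A schema over the algebraic theory `T`: a small category of entities and an algebraic
profunctor of observables from it to `T`. -/
structure Schema (T : Type u) [SmallCategory T] where
  Ent : Type u
  [entCat : SmallCategory Ent]
  obs : Entᵒᵖ ⥤ T ⥤ Type u
  algebraic : ∀ e : Ent, PreservesFiniteProducts (obs.obj (op e))

attribute [instance] Schema.entCat

/-- A schema mapping: a functor between the entity categories and a 2-cell of profunctors lying
over it and over the identity of `T`. -/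
@[ext]
structure Schema.Map (R S : Schema T) where
  ent : R.Ent ⥤ S.Ent
  obs : R.obs ⟶ ent.op ⋙ S.obs

instance : Category (Schema T) where
  Hom R S := Schema.Map R S
  id R := { ent := 𝟭 _, obs := 𝟙 R.obs }
  comp F G :=
    { ent := F.ent ⋙ G.ent
      obs := F.obs ≫ Functor.whiskerLeft F.ent.op G.obs }
  id_comp _ := rfl
  comp_id _ := rfl
  assoc _ _ _ := rfl

/-- Objects of the collage of a schema. -/
inductive Coll (S : Schema T) : Type u
  | ent (e : S.Ent)
  | ty (t : T)

namespace Coll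

variable {R S : Schema T}

/-- Morphisms of the collage; there are none from types to entities. -/
def Hom (S : Schema T) : Coll S → Coll S → Type u
  | ent a, ent b => a ⟶ b
  | ent a, ty t => (S.obs.obj (op a)).obj t
  | ty _, ent _ => PEmpty
  | ty s, ty t => s ⟶ t

def id : (a : Coll S) → Hom S a a
  | ent a => 𝟙 a
  | ty t => 𝟙 t

def comp : {a b c : Coll S} → Hom S a b → Hom S b c → Hom S a c
  | ent _, ent _, ent _, f, g => CategoryStruct.comp (obj := S.Ent) f g
  | ent _, ent _, ty t, f, g => (S.obs.map (Quiver.Hom.op (V := S.Ent) f)).app t g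
  | ent a, ty _, ty _, f, g => (S.obs.obj (op a)).map g f
  | ty _, ty _, ty _, f, g => CategoryStruct.comp (obj := T) f g

instance : SmallCategory (Coll S) where
  Hom a b := Hom S a b
  id a := Coll.id a
  comp f g := Coll.comp f g
  id_comp {a b} f := by
    cases a <;> cases b <;> first | exact PEmpty.elim f | skip
    · exact Category.id_comp (obj := S.Ent) f
    · rename_i a t
      exact types_congr_hom (NatTrans.congr_app (S.obs.map_id (op a)) t) f
    · exact Category.id_comp (obj := T) f
  comp_id {a b} f := by
    cases a <;> cases b <;> first | exact PEmpty.elim f | skip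
    · exact Category.comp_id (obj := S.Ent) f
    · rename_i a t
      exact types_congr_hom ((S.obs.obj (op a)).map_id t) f
    · exact Category.comp_id (obj := T) f
  assoc {a b c d} f g h := by
    cases a <;> cases b <;> first | exact PEmpty.elim f | skip
    all_goals cases c <;> first | exact PEmpty.elim g | skip
    all_goals cases d <;> first | exact PEmpty.elim h | skip
    · exact Category.assoc (obj := S.Ent) f g h
    · rename_i a b c t
      exact types_congr_hom (NatTrans.congr_app (S.obs.map_comp
        (Quiver.Hom.op (V := S.Ent) g) (Quiver.Hom.op (V := S.Ent) f)) t) h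
    · rename_i a b c t
      exact (NatTrans.naturality_apply (S.obs.map (Quiver.Hom.op (V := S.Ent) f)) h g).symm
    · rename_i a b c t
      exact (types_congr_hom ((S.obs.obj (op a)).map_comp g h) f).symm
    · exact Category.assoc (obj := T) f g h

/-- The inclusion of `T` into the collage. -/
def inT (S : Schema T) : T ⥤ Coll S where
  obj t := ty t
  map f := f
  map_id _ := rfl
  map_comp _ _ := rfl

/-- A morphism of `T`, as a morphism of the collage. -/
def tyHom (S : Schema T) {t t' : T} (f : t ⟶ t') : (ty t : Coll S) ⟶ ty t' := f

def mapHom (F : R ⟶ S) : (a b : Coll R) → (a ⟶ b) →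
    ((match a with | ent e => ent (F.ent.obj e) | ty t => ty t : Coll S) ⟶
      (match b with | ent e => ent (F.ent.obj e) | ty t => ty t : Coll S))
  | ent _, ent _, f => F.ent.map f
  | ent a, ty t, f => (F.obs.app (op a)).app t f
  | ty _, ty _, f => f

/-- The functor between collages induced by a schema mapping. -/
def map (F : R ⟶ S) : Coll R ⥤ Coll S where
  obj a := match a with | ent e => ent (F.ent.obj e) | ty t => ty t
  map {a b} f := mapHom F a b f
  map_id a := by
    cases a
    · exact F.ent.map_id _
    · rfl
  map_comp {a b c} f g := by
    cases a <;> cases b <;> first | exact PEmpty.elim f | skip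
    all_goals cases c <;> first | exact PEmpty.elim g | skip
    · exact F.ent.map_comp _ _
    · rename_i a b t
      exact (types_congr_hom (NatTrans.congr_app
        (F.obs.naturality (Quiver.Hom.op (V := R.Ent) f)) t) g)
    · exact (NatTrans.naturality_apply (F.obs.app _) g f)
    · rfl

/-- On collages, the identity mapping induces the identity. -/
def mapId (S : Schema T) : map (𝟙 S) ≅ 𝟭 (Coll S) :=
  NatIso.ofComponents (fun a => match a with
    | ent _ => Iso.refl _
    | ty _ => Iso.refl _) (by
    intro a b f
    cases a <;> cases b <;> first | exact PEmpty.elim f | skip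
    all_goals exact (Category.comp_id _).trans (Category.id_comp _).symm)

/-- On collages, composition of mappings induces composition. -/
def mapComp {Q : Schema T} (F : Q ⟶ R) (G : R ⟶ S) : map (F ≫ G) ≅ map F ⋙ map G :=
  NatIso.ofComponents (fun a => match a with
    | ent _ => Iso.refl _
    | ty _ => Iso.refl _) (by
    intro a b f
    cases a <;> cases b <;> first | exact PEmpty.elim f | skip
    all_goals exact (Category.comp_id _).trans (Category.id_comp _).symm)

end Coll

/-- Instances of a schema: set-valued functors on the collage whose restriction to `T` preserves
finite products. -/
def isInst (S : Schema T) : ObjectProperty (Coll S ⥤ Type u) :=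
  fun I => PreservesFiniteProducts (Coll.inT S ⋙ I)

abbrev Inst (S : Schema T) := (isInst S).FullSubcategory

end AlgData

end

noncomputable section

namespace AlgData

section Cocomplete

variable {T : Type u} [SmallCategory T] [HasFiniteProducts T] {C : Type u} [SmallCategory C]

lemma preservesFiniteProducts_iff (F : T ⥤ Type u) :
    PreservesFiniteProducts F ↔ ∀ (n : ℕ) (f : Fin n → T),
      Function.Bijective (fun (x : F.obj (∏ᶜ f)) (i : Fin n) => F.map (Pi.π f i) x) := by
  have key (n : ℕ) (f : Fin n → T) : PreservesLimit (Discrete.functor f) F ↔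
      Function.Bijective (fun (x : F.obj (∏ᶜ f)) (i : Fin n) => F.map (Pi.π f i) x) := by
    have h1 : PreservesLimit (Discrete.functor f) F ↔
        Nonempty (IsLimit (F.mapCone (limit.cone (Discrete.functor f)))) :=
      ⟨fun _ => ⟨isLimitOfPreserves F (limit.isLimit _)⟩,
        fun ⟨h⟩ => preservesLimit_of_preserves_limit_cone (limit.isLimit _) h⟩
    rw [h1, Types.isLimit_iff, Function.bijective_iff_existsUnique]
    constructor
    · intro h s
      obtain ⟨x, hx, hu⟩ := h (fun j => s j.as) (by
        rintro ⟨i⟩ ⟨j⟩ ⟨⟨g⟩⟩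
        dsimp at g
        subst g
        exact types_congr_hom (F.map_id _) _)
      exact ⟨x, funext fun i => hx ⟨i⟩, fun y hy => hu y fun j => congrFun hy j.as⟩
    · intro h s hs
      obtain ⟨x, hx, hu⟩ := h (fun i => s ⟨i⟩)
      exact ⟨x, fun j => congrFun hx j.as, fun y hy => hu y (funext fun i => hy ⟨i⟩)⟩
  constructor
  · intro h n f
    exact (key n f).1 inferInstance
  · intro h
    refine ⟨fun n => ?_⟩
    have (f : Fin n → T) : PreservesLimit (Discrete.functor f) F := (key n f).2 (h n f)
    exact preservesLimitsOfShape_of_discrete F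

/-- The comparison maps which an algebra has to see as isomorphisms. -/
def prodComparison (i : T ⥤ C) (p : Σ n : ℕ, Fin n → T) :
    (∐ fun k : Fin p.1 => coyoneda.obj (op (i.obj (p.2 k)))) ⟶
      coyoneda.obj (op (i.obj (∏ᶜ p.2))) :=
  Sigma.desc fun k => coyoneda.map (i.map (Pi.π p.2 k)).op

lemma algebras_eq_isLocal (i : T ⥤ C) :
    (fun I : C ⥤ Type u => PreservesFiniteProducts (i ⋙ I)) =
      (MorphismProperty.ofHoms (prodComparison i)).isLocal := by
  ext I
  rw [preservesFiniteProducts_iff]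
  have key (n : ℕ) (f : Fin n → T) :
      Function.Bijective (fun (x : (i ⋙ I).obj (∏ᶜ f)) (k : Fin n) => (i ⋙ I).map (Pi.π f k) x) ↔
        Function.Bijective (fun g : _ ⟶ I => prodComparison i ⟨n, f⟩ ≫ g) := by
    let e : ((∐ fun k : Fin n => coyoneda.obj (op (i.obj (f k)))) ⟶ I) ≃
        (∀ k, I.obj (i.obj (f k))) :=
      { toFun := fun g k => coyonedaEquiv (Sigma.ι
          (fun k : Fin n => coyoneda.obj (op (i.obj (f k)))) k ≫ g)
        invFun := fun s => Sigma.desc fun k => coyonedaEquiv.symm (s k)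
        left_inv := fun g => by
          refine Sigma.hom_ext _ _ fun k => ?_
          simp
        right_inv := fun s => by
          funext k
          simp }
    rw [← Function.Bijective.of_comp_iff' e.bijective,
      ← Function.Bijective.of_comp_iff _ (coyonedaEquiv (F := I)).symm.bijective]
    have : ((⇑e ∘ fun g : _ ⟶ I => prodComparison i ⟨n, f⟩ ≫ g) ∘ ⇑coyonedaEquiv.symm) =
        (fun (x : (i ⋙ I).obj (∏ᶜ f)) (k : Fin n) => (i ⋙ I).map (Pi.π f k) x) := by
      funext x k
      change coyonedaEquiv (Sigma.ι (fun k : Fin n => coyoneda.obj (op (i.obj (f k)))) k ≫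
        Sigma.desc (fun k => coyoneda.map (i.map (Pi.π f k)).op) ≫ coyonedaEquiv.symm x) = _
      rw [← Category.assoc, Sigma.ι_desc, ← coyonedaEquiv_naturality, Equiv.apply_symm_apply]
      rfl
    rw [this]
  constructor
  · rintro h X Y f ⟨⟨n, p⟩⟩
    exact (key n p).1 (h n p)
  · intro h n p
    exact (key n p).2 (h (prodComparison i ⟨n, p⟩)
      (MorphismProperty.ofHoms.mk (⟨n, p⟩ : Σ n : ℕ, Fin n → T)))

lemma algebras_hasColimits (i : T ⥤ C) : HasColimitsOfSize.{u, u}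
    (ObjectProperty.FullSubcategory
      (fun I : C ⥤ Type u => PreservesFiniteProducts (i ⋙ I))) := by
  rw [algebras_eq_isLocal]
  have : Fact (Cardinal.aleph0.{u}).IsRegular := ⟨Cardinal.isRegular_aleph0⟩
  have pres (X : C) : IsCardinalPresentable (coyoneda.obj (op X) : C ⥤ Type u)
      Cardinal.aleph0.{u} :=
    { preservesColimitOfShape := fun J _ _ => by
        let e : coyoneda.obj (op (coyoneda.obj (op X) : C ⥤ Type u)) ≅
            (evaluation C (Type u)).obj X :=
          NatIso.ofComponents (fun P => Equiv.toIso coyonedaEquiv)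
            (fun {P Q} f => by ext g; exact coyonedaEquiv_comp g f)
        exact preservesColimitsOfShape_of_natIso e.symm }
  have := MorphismProperty.isRightAdjoint_ι_isLocal
    (MorphismProperty.ofHoms (prodComparison i)) Cardinal.aleph0.{u} (by
      rintro X Y f ⟨⟨n, p⟩⟩
      refine ⟨?_, pres _⟩
      have (k : Discrete (Fin n)) : IsCardinalPresentable
          ((Discrete.functor fun k => (coyoneda.obj (op (i.obj (p k))) : C ⥤ Type u)).obj k)
          Cardinal.aleph0.{u} := pres _
      refine isCardinalPresentable_of_isColimit _ (colimit.isColimit (Discrete.functor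
        fun k : Fin n => (coyoneda.obj (op (i.obj (p k))) : C ⥤ Type u))) _ ?_
      rw [hasCardinalLT_aleph0_iff]
      infer_instance)
  let _ : Reflective (MorphismProperty.ofHoms (prodComparison i)).isLocal.ι :=
    ⟨_, Adjunction.ofIsRightAdjoint _⟩
  exact hasColimits_of_reflective (MorphismProperty.ofHoms (prodComparison i)).isLocal.ι

end Cocomplete
end AlgData

end

noncomputable section

namespace AlgData

variable {T : Type u} [SmallCategory T]

instance [HasFiniteProducts T] (S : Schema T) : HasColimitsOfSize.{u, u} (Inst S) :=
  algebras_hasColimits (Coll.inT S)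

variable {Q R S U : Schema T}

lemma preservesFiniteProducts_ofIso {F G : T ⥤ Type u} (e : F ≅ G)
    (h : PreservesFiniteProducts F) : PreservesFiniteProducts G :=
  ⟨fun _ => preservesLimitsOfShape_of_natIso e⟩

lemma isInst_coyoneda (S : Schema T) (a : Coll S) : isInst S (coyoneda.obj (op a)) := by
  cases a with
  | ent e =>
    exact preservesFiniteProducts_ofIso (NatIso.ofComponents (fun t => Iso.refl _)
      (fun f => by ext x; rfl) : S.obs.obj (op e) ≅ _) (S.algebraic e)
  | ty t =>
    exact preservesFiniteProducts_ofIso (NatIso.ofComponents (fun t => Iso.refl _)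
      (fun f => by ext x; rfl) : coyoneda.obj (op t) ≅ _) inferInstance

/-- The Yoneda embedding of the collage into the category of instances. -/
def y (S : Schema T) : (Coll S)ᵒᵖ ⥤ Inst S :=
  (isInst S).lift coyoneda fun a => isInst_coyoneda S a.unop

section Elements

variable {I J K : Inst S} {a s s' s'' : Coll S}

/-- The action of a morphism of the collage on an element of an instance. -/
def act (f : s ⟶ s') (x : I.obj.obj s) : I.obj.obj s' := I.obj.map f x

/-- The action of a morphism of instances on an element. -/
def ap (h : I ⟶ J) (x : I.obj.obj s) : J.obj.obj s := h.hom.app s x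

/-- A morphism of the collage, as an element of a representable instance. -/
def ofHom (f : s ⟶ s') : ((y S).obj (op s)).obj.obj s' := f

/-- An element of a representable instance, as a morphism of the collage. -/
def toHom (x : ((y S).obj (op s)).obj.obj s') : s ⟶ s' := x

@[simp] lemma ofHom_toHom (x : ((y S).obj (op s)).obj.obj s') : ofHom (toHom x) = x := rfl

@[simp] lemma toHom_ofHom (f : s ⟶ s') : toHom (ofHom f) = f := rfl

lemma act_ofHom (f : s ⟶ s') (g : s' ⟶ s'') : act g (ofHom f) = ofHom (f ≫ g) := rfl

lemma toHom_act (x : ((y S).obj (op s)).obj.obj s') (g : s' ⟶ s'') :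
    toHom (act g x) = toHom x ≫ g := rfl

lemma act_id (x : I.obj.obj s) : act (𝟙 s) x = x := by simp [act]

lemma act_comp (f : s ⟶ s') (f' : s' ⟶ s'') (x : I.obj.obj s) :
    act (f ≫ f') x = act f' (act f x) := by simp [act]

@[simp] lemma ap_id (x : I.obj.obj s) : ap (𝟙 I) x = x := rfl

@[simp] lemma ap_comp (h : I ⟶ J) (k : J ⟶ K) (x : I.obj.obj s) :
    ap (h ≫ k) x = ap k (ap h x) := rfl

lemma ap_act (h : I ⟶ J) (f : s ⟶ s') (x : I.obj.obj s) : ap h (act f x) = act f (ap h x) :=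
  NatTrans.naturality_apply h.hom f x

lemma inst_ext {h k : I ⟶ J} (w : ∀ (s : Coll S) (x : I.obj.obj s), ap h x = ap k x) : h = k := by
  apply ObjectProperty.hom_ext
  ext s x
  exact w s x

/-- The morphism out of a representable corresponding to an element of an instance. -/
def el (x : I.obj.obj s) : (y S).obj (op s) ⟶ I :=
  ObjectProperty.homMk (coyonedaEquiv.symm x)

/-- The element of an instance corresponding to a morphism out of a representable. -/
def ev (g : (y S).obj (op s) ⟶ I) : I.obj.obj s := ap g (ofHom (𝟙 s))

lemma ap_el (x : I.obj.obj s) (f : s ⟶ s') : ap (el x) (ofHom f) = act f x := rfl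

@[simp] lemma ev_el (x : I.obj.obj s) : ev (el x) = x := act_id x

@[simp] lemma el_ev (g : (y S).obj (op s) ⟶ I) : el (ev g) = g := by
  apply ObjectProperty.hom_ext
  exact coyonedaEquiv.symm_apply_apply g.hom

lemma el_comp (x : I.obj.obj s) (h : I ⟶ J) : el x ≫ h = el (ap h x) := by
  rw [← el_ev (el x ≫ h)]
  congr 1
  exact congrArg (ap h) (ev_el x)

lemma y_map_el (f : s ⟶ s') (x : I.obj.obj s) : (y S).map f.op ≫ el x = el (act f x) := by
  rw [← el_ev ((y S).map f.op ≫ el x)]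
  congr 1
  change ap (el x) ((show (s ⟶ s') from f) ≫ 𝟙 s') = _
  rw [Category.comp_id]
  rfl

lemma ev_comp (g : (y S).obj (op s) ⟶ I) (h : I ⟶ J) : ev (g ≫ h) = ap h (ev g) := rfl

lemma ev_map (f : s ⟶ s') (g : (y S).obj (op s) ⟶ I) : ev ((y S).map f.op ≫ g) = act f (ev g) := by
  rw [← el_ev g, y_map_el, ev_el, ev_el]

lemma y_ext {g h : (y S).obj (op s) ⟶ I} (w : ev g = ev h) : g = h := by
  rw [← el_ev g, w, el_ev]

end Elements

/-- Restriction of instances along a schema mapping. -/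
def Δ (F : R ⟶ S) : Inst S ⥤ Inst R where
  obj I := ⟨Coll.map F ⋙ I.obj, I.property⟩
  map h := ObjectProperty.homMk (Functor.whiskerLeft (Coll.map F) h.hom)

/-- The left Kan extension of `M` along the Yoneda embedding, computed pointwise by colimits. -/
def Λ [HasFiniteProducts T] (M : (Coll R)ᵒᵖ ⥤ Inst S) : Inst R ⥤ Inst S :=
  (y R).pointwiseLeftKanExtension M

section Lan

variable [HasFiniteProducts T] (M : (Coll R)ᵒᵖ ⥤ Inst S) {I I' : Inst R} {J : Inst S}
  {r r' : Coll R}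

/-- The coprojections into `Λ M I`. -/
def inj (x : I.obj.obj r) : M.obj (op r) ⟶ (Λ M).obj I :=
  colimit.ι (CostructuredArrow.proj (y R) I ⋙ M) (CostructuredArrow.mk (el x))

lemma map_inj (f : r ⟶ r') (x : I.obj.obj r) : M.map f.op ≫ inj M x = inj M (act f x) :=
  colimit.w (CostructuredArrow.proj (y R) I ⋙ M)
    (CostructuredArrow.homMk f.op (y_map_el f x) :
      CostructuredArrow.mk (el (act f x)) ⟶ CostructuredArrow.mk (el x))

lemma inj_map (h : I ⟶ I') (x : I.obj.obj r) : inj M x ≫ (Λ M).map h = inj M (ap h x) := by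
  refine (colimit.ι_desc _ _).trans ?_
  change colimit.ι (CostructuredArrow.proj (y R) I' ⋙ M) (CostructuredArrow.mk (el x ≫ h)) = _
  rw [el_comp]
  rfl

variable {M} in
lemma Λ_ext {h k : (Λ M).obj I ⟶ J}
    (w : ∀ (r : Coll R) (x : I.obj.obj r), inj M x ≫ h = inj M x ≫ k) : h = k := by
  refine colimit.hom_ext fun j => ?_
  obtain ⟨⟨r⟩, ⟨⟩, g⟩ := j
  have := w r (ev g)
  dsimp only [inj] at this
  rw [el_ev] at this
  exact this

/-- Maps out of `Λ M I` are compatible families indexed by the elements of `I`. -/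
def desc (k : ∀ (r : Coll R), I.obj.obj r → (M.obj (op r) ⟶ J))
    (hk : ∀ (r r' : Coll R) (f : r ⟶ r') (x : I.obj.obj r), M.map f.op ≫ k r x = k r' (act f x)) :
    (Λ M).obj I ⟶ J :=
  colimit.desc (CostructuredArrow.proj (y R) I ⋙ M)
    { pt := J
      ι :=
        { app := fun j => k j.left.unop (ev j.hom)
          naturality := fun i j f => by
            change M.map f.left ≫ k j.left.unop (ev j.hom) = k i.left.unop (ev i.hom) ≫ 𝟙 J
            rw [Category.comp_id, ← CostructuredArrow.w f]
            refine (hk _ _ f.left.unop _).trans ?_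
            congr 1
            exact (ev_map f.left.unop j.hom).symm } }

@[simp] lemma inj_desc (k : ∀ (r : Coll R), I.obj.obj r → (M.obj (op r) ⟶ J)) (hk) (x : I.obj.obj r) :
    inj M x ≫ desc M k hk = k r x := by
  refine (colimit.ι_desc _ _).trans ?_
  change k r (ev (el x)) = k r x
  rw [ev_el]

/-- `Λ M` extends `M`. -/
def ΛyIso (r : Coll R) : (Λ M).obj ((y R).obj (op r)) ≅ M.obj (op r) where
  hom := desc M (fun _ f => M.map (toHom f).op) (fun _ _ f g => by
    rw [toHom_act, op_comp, M.map_comp])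
  inv := inj M (ofHom (𝟙 r))
  hom_inv_id := Λ_ext fun s f => by
    rw [← Category.assoc, inj_desc, Category.comp_id, map_inj, act_ofHom, Category.id_comp,
      ofHom_toHom]
  inv_hom_id := (inj_desc M _ _ _).trans (M.map_id _)

lemma inj_ΛyIso (f : r ⟶ r') : inj M (ofHom f) ≫ (ΛyIso M r).hom = M.map f.op :=
  inj_desc M _ _ _

lemma ΛyIso_nat (f : r ⟶ r') :
    (Λ M).map ((y R).map f.op) ≫ (ΛyIso M r).hom = (ΛyIso M r').hom ≫ M.map f.op :=
  Λ_ext fun s x => by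
    rw [← ofHom_toHom x, ← Category.assoc, inj_map, ← Category.assoc, inj_ΛyIso, ← M.map_comp]
    exact inj_ΛyIso M (f ≫ toHom x)

end Lan

/-- A bimodule from `R` to `S`: a functor from the opposite of the collage of `R` to instances of
`S` which, naturally, sends every type to the instance represented by that type. -/
structure Bimod (R S : Schema T) where
  F : (Coll R)ᵒᵖ ⥤ Inst S
  tyIso (t : T) : F.obj (op (.ty t)) ≅ (y S).obj (op (.ty t))
  tyIso_nat {t t' : T} (f : t ⟶ t') : F.map (Coll.tyHom R f).op ≫ (tyIso t).hom =
    (tyIso t').hom ≫ (y S).map (Coll.tyHom S f).op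

namespace Bimod

/-- A morphism of bimodules: a natural transformation which restricts to the identity on types. -/
@[ext]
structure Hom (M N : Bimod R S) where
  nat : M.F ⟶ N.F
  nat_ty (t : T) : nat.app (op (.ty t)) ≫ (N.tyIso t).hom = (M.tyIso t).hom

instance : Category (Bimod R S) where
  Hom M N := Hom M N
  id M := ⟨𝟙 M.F, fun t => Category.id_comp _⟩
  comp θ φ := ⟨θ.nat ≫ φ.nat, fun t => by
    rw [NatTrans.comp_app, Category.assoc, φ.nat_ty, θ.nat_ty]⟩
  id_comp θ := Hom.ext (Category.id_comp θ.nat)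
  comp_id θ := Hom.ext (Category.comp_id θ.nat)
  assoc θ φ ψ := Hom.ext (Category.assoc θ.nat φ.nat ψ.nat)

lemma tyIso_inv_nat (M : Bimod R S) {t t' : T} (f : t ⟶ t') :
    (y S).map (Coll.tyHom S f).op ≫ (M.tyIso t).inv =
      (M.tyIso t').inv ≫ M.F.map (Coll.tyHom R f).op := by
  rw [Iso.comp_inv_eq, Category.assoc, M.tyIso_nat, Iso.inv_hom_id_assoc]

/-- The functor `J ↦ Hom(M(-), J)` from instances of `S` to instances of `R`. -/
def Γ (M : Bimod R S) : Inst S ⥤ Inst R where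
  obj J :=
    { obj :=
        { obj := fun r => M.F.obj (op r) ⟶ J
          map := fun f => ↾fun g => M.F.map f.op ≫ g
          map_id := fun r => by ext g; simp
          map_comp := fun f f' => by ext g; simp }
      property := preservesFiniteProducts_ofIso
        (NatIso.ofComponents (fun t => Equiv.toIso
          { toFun := fun x => (M.tyIso t).hom ≫ el (s := .ty t) x
            invFun := fun g => ev ((M.tyIso t).inv ≫ g)
            left_inv := fun x =>
              (congrArg ev (Iso.inv_hom_id_assoc (M.tyIso t) _)).trans (ev_el (s := .ty t) x)
            right_inv := fun g =>
              (congrArg _ (el_ev _)).trans (Iso.hom_inv_id_assoc (M.tyIso t) _) })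
          (fun {t t'} f => by
            ext x
            change (M.tyIso t').hom ≫ el (act (Coll.tyHom S f) x) =
              M.F.map (Coll.tyHom R f).op ≫ (M.tyIso t).hom ≫ el (s := .ty t) x
            refine (congrArg _ (y_map_el (s := .ty t) (Coll.tyHom S f) x).symm).trans ?_
            rw [← Category.assoc, ← Category.assoc, tyIso_nat]))
        J.property }
  map h :=
    ObjectProperty.homMk { app := fun r => ↾fun g => g ≫ h
                           naturality := fun r r' f => by ext g; simp }

section

variable (M : Bimod R S) {J K : Inst S} {r r' : Coll R}

/-- An element of `Γ J`, as a morphism. -/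
def Γhom {M : Bimod R S} (x : (M.Γ.obj J).obj.obj r) : M.F.obj (op r) ⟶ J := x

/-- A morphism, as an element of `Γ J`. -/
def Γel {M : Bimod R S} (g : M.F.obj (op r) ⟶ J) : (M.Γ.obj J).obj.obj r := g

@[simp] lemma Γhom_Γel (g : M.F.obj (op r) ⟶ J) : Γhom (Γel g) = g := rfl

@[simp] lemma Γel_Γhom (x : (M.Γ.obj J).obj.obj r) : Γel (Γhom x) = x := rfl

lemma act_Γel (f : r ⟶ r') (g : M.F.obj (op r) ⟶ J) : act f (Γel g) = Γel (M.F.map f.op ≫ g) := rfl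

lemma Γhom_act (f : r ⟶ r') (x : (M.Γ.obj J).obj.obj r) :
    Γhom (act f x) = M.F.map f.op ≫ Γhom x := rfl

lemma ap_Γ_map (h : J ⟶ K) (x : (M.Γ.obj J).obj.obj r) :
    ap (M.Γ.map h) x = Γel (Γhom x ≫ h) := rfl

end

variable [HasFiniteProducts T]

section

variable (M : Bimod R S) {I I' : Inst R} {J J' : Inst S} {r : Coll R}

/-- The transpose of a morphism out of `Λ I`. -/
def transpose (g : (Λ M.F).obj I ⟶ J) : I ⟶ M.Γ.obj J :=
  ObjectProperty.homMk
    { app := fun r => ↾fun x => Γel (inj M.F x ≫ g)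
      naturality := fun r r' f => by
        refine ConcreteCategory.hom_ext _ _ fun (x : I.obj.obj r) => ?_
        change Γel (M := M) (inj M.F (act f x) ≫ g) = act f (Γel (M := M) (inj M.F x ≫ g))
        rw [← map_inj, Category.assoc, act_Γel] }

/-- The transpose of a morphism into `Γ J`. -/
def untranspose (h : I ⟶ M.Γ.obj J) : (Λ M.F).obj I ⟶ J :=
  desc M.F (fun r x => Γhom (ap h x)) (fun r r' f x => by rw [ap_act, Γhom_act])

lemma ap_transpose (g : (Λ M.F).obj I ⟶ J) (x : I.obj.obj r) :
    ap (M.transpose g) x = Γel (inj M.F x ≫ g) := rfl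

lemma inj_untranspose (h : I ⟶ M.Γ.obj J) (x : I.obj.obj r) :
    inj M.F x ≫ M.untranspose h = Γhom (ap h x) := inj_desc M.F _ _ _

/-- The adjunction between `Λ` and `Γ`. -/
def adj : Λ M.F ⊣ M.Γ :=
  Adjunction.mkOfHomEquiv
    { homEquiv := fun I J =>
        { toFun := M.transpose
          invFun := M.untranspose
          left_inv := fun g => Λ_ext fun r x => M.inj_untranspose _ _
          right_inv := fun h => inst_ext fun r x => M.inj_untranspose _ _ }
      homEquiv_naturality_left_symm := fun f g => Λ_ext fun r x => by
        change inj M.F x ≫ M.untranspose (f ≫ g) = inj M.F x ≫ (Λ M.F).map f ≫ M.untranspose g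
        rw [inj_untranspose, ← Category.assoc, inj_map, inj_untranspose, ap_comp]
      homEquiv_naturality_right := fun {I J K} f g => inst_ext fun r x => by
        change ap (M.transpose (f ≫ g)) x = ap (M.Γ.map g) (ap (M.transpose f) x)
        rw [ap_transpose, ap_Γ_map, ap_transpose, Γhom_Γel, Category.assoc] }

end

end Bimod

end AlgData

end

noncomputable section

namespace AlgData

variable {T : Type u} [SmallCategory T] {R S U V : Schema T}

namespace Bimod

lemma hom_ext {M M' : Bimod R S} {θ φ : M ⟶ M'} (w : ∀ r, θ.nat.app (op r) = φ.nat.app (op r)) : θ = φ :=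
  Hom.ext (NatTrans.ext (funext fun r => w r.unop))

section Elements

variable (M : Bimod R S) {M' : Bimod R S}

/-- The contravariant action on the elements of a bimodule. -/
def bmap {r r' : Coll R} {s : Coll S} (f : r ⟶ r') (x : (M.F.obj (op r')).obj.obj s) :
    (M.F.obj (op r)).obj.obj s := ap (M.F.map f.op) x

variable {M} in
lemma bmap_nat (θ : M ⟶ M') {r r' : Coll R} {s : Coll S} (f : r ⟶ r')
    (x : (M.F.obj (op r')).obj.obj s) :
    M'.bmap f (ap (θ.nat.app (op r')) x) = ap (θ.nat.app (op r)) (M.bmap f x) := by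
  unfold bmap
  rw [← ap_comp, ← ap_comp, θ.nat.naturality]

/-- The morphism corresponding to an element of a bimodule at a type. -/
def tyHom {t : T} {s : Coll S} (x : (M.F.obj (op (.ty t))).obj.obj s) : Coll.ty t ⟶ s :=
  toHom (ap (M.tyIso t).hom x)

lemma bmap_id {r : Coll R} {s : Coll S} (x : (M.F.obj (op r)).obj.obj s) :
    M.bmap (𝟙 r) x = x := by
  unfold bmap
  rw [op_id, M.F.map_id]
  rfl

lemma bmap_comp {r r' r'' : Coll R} {s : Coll S} (f : r ⟶ r') (g : r' ⟶ r'')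
    (x : (M.F.obj (op r'')).obj.obj s) : M.bmap (f ≫ g) x = M.bmap f (M.bmap g x) := by
  unfold bmap
  rw [op_comp, M.F.map_comp]
  rfl

lemma bmap_act {r r' : Coll R} {s s' : Coll S} (f : r ⟶ r') (g : s ⟶ s')
    (x : (M.F.obj (op r')).obj.obj s) : M.bmap f (act g x) = act g (M.bmap f x) :=
  ap_act _ _ _

lemma tyHom_act {t : T} {s s' : Coll S} (x : (M.F.obj (op (.ty t))).obj.obj s) (g : s ⟶ s') :
    M.tyHom (act g x) = M.tyHom x ≫ g := by
  unfold tyHom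
  rw [ap_act, toHom_act]

variable {M} in
lemma tyHom_nat (θ : M ⟶ M') {t : T} {s : Coll S} (x : (M.F.obj (op (.ty t))).obj.obj s) :
    M'.tyHom (ap (θ.nat.app _) x) = M.tyHom x := by
  unfold tyHom
  rw [← ap_comp, θ.nat_ty]

end Elements

end Bimod

variable [HasFiniteProducts T]

/-- Functoriality of `Λ` in the bimodule. -/
def ΛMap {M N : (Coll R)ᵒᵖ ⥤ Inst S} (φ : M ⟶ N) : Λ M ⟶ Λ N where
  app I := desc M (fun r x => φ.app (op r) ≫ inj N x) (fun r r' f x => by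
    rw [← Category.assoc, φ.naturality, Category.assoc, map_inj])
  naturality I J h := Λ_ext fun r x => by
    rw [← Category.assoc, inj_map, inj_desc, ← Category.assoc, inj_desc, Category.assoc, inj_map]

namespace Bimod

/-- The composite of bimodules. -/
def comp (M : Bimod R S) (N : Bimod S U) : Bimod R U where
  F := M.F ⋙ Λ N.F
  tyIso t := (Λ N.F).mapIso (M.tyIso t) ≪≫ ΛyIso N.F (.ty t) ≪≫ N.tyIso t
  tyIso_nat {t t'} f := by
    have h := congrArg (Λ N.F).map (M.tyIso_nat f)
    rw [(Λ N.F).map_comp, (Λ N.F).map_comp] at h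
    simp only [Functor.comp_map, Iso.trans_hom, Functor.mapIso_hom, Category.assoc]
    rw [← Category.assoc, h, Category.assoc, ← N.tyIso_nat f, ← Category.assoc _ (ΛyIso _ _).hom,
      ΛyIso_nat]
    simp only [Category.assoc]

lemma comp_tyIso_hom (M : Bimod R S) (N : Bimod S U) (t : T) : ((M.comp N).tyIso t).hom =
    (Λ N.F).map (M.tyIso t).hom ≫ (ΛyIso N.F (.ty t)).hom ≫ (N.tyIso t).hom := rfl

/-- The unit bimodule. -/
def unit (R : Schema T) : Bimod R R where
  F := y R
  tyIso _ := Iso.refl _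
  tyIso_nat _ := (Category.comp_id _).trans (Category.id_comp _).symm

section Elements

variable (M : Bimod R S) (N : Bimod S U) (P : Bimod U V)

/-- The generating elements of a composite of bimodules. -/
def tmul {r : Coll R} {s : Coll S} {u : Coll U} (x : (M.F.obj (op r)).obj.obj s)
    (z : (N.F.obj (op s)).obj.obj u) : ((M.comp N).F.obj (op r)).obj.obj u := ap (inj N.F x) z

variable {r r' : Coll R} {s s' : Coll S} {u u' : Coll U}

lemma tmul_act (x : (M.F.obj (op r)).obj.obj s) (z : (N.F.obj (op s)).obj.obj u) (g : u ⟶ u') :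
    act g (M.tmul N x z) = M.tmul N x (act g z) := (ap_act _ _ _).symm

lemma tmul_bmap (x : (M.F.obj (op r)).obj.obj s) (z : (N.F.obj (op s')).obj.obj u) (g : s ⟶ s') :
    M.tmul N x (N.bmap g z) = M.tmul N (act g x) z := by
  refine Eq.trans ?_ (congrArg (fun k => ap k z) (map_inj N.F g x))
  rfl

lemma bmap_tmul (x : (M.F.obj (op r')).obj.obj s) (z : (N.F.obj (op s)).obj.obj u) (f : r ⟶ r') :
    (M.comp N).bmap f (M.tmul N x z) = M.tmul N (M.bmap f x) z := by
  change ap ((Λ N.F).map (M.F.map f.op)) (ap (inj N.F x) z) = _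
  rw [← ap_comp, inj_map]
  rfl

lemma tyHom_tmul {t : T} (x : (M.F.obj (op (.ty t))).obj.obj s) (z : (N.F.obj (op s)).obj.obj u) :
    (M.comp N).tyHom (M.tmul N x z) = N.tyHom (N.bmap (M.tyHom x) z) := by
  unfold tyHom tmul
  rw [comp_tyIso_hom]
  have : inj N.F x ≫ (Λ N.F).map (M.tyIso t).hom ≫ (ΛyIso N.F (.ty t)).hom ≫ (N.tyIso t).hom =
      N.F.map (toHom (ap (M.tyIso t).hom x)).op ≫ (N.tyIso t).hom := by
    rw [← Category.assoc, inj_map, ← Category.assoc]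
    congr 1
    exact inj_ΛyIso N.F (toHom (ap (M.tyIso t).hom x))
  exact congrArg (fun g => toHom (ap g z)) this

variable {M N P} in
lemma comp_ext {J : Inst U} {h k : (M.comp N).F.obj (op r) ⟶ J}
    (w : ∀ (s : Coll S) (u : Coll U) (x : (M.F.obj (op r)).obj.obj s)
      (z : (N.F.obj (op s)).obj.obj u), ap h (M.tmul N x z) = ap k (M.tmul N x z)) : h = k :=
  Λ_ext fun s x => inst_ext fun u z => w s u x z

variable {M N P} in
lemma comp_ext₃ {J : Inst V} {h k : ((M.comp N).comp P).F.obj (op r) ⟶ J}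
    (w : ∀ (s : Coll S) (u : Coll U) (v : Coll V) (x : (M.F.obj (op r)).obj.obj s)
      (z : (N.F.obj (op s)).obj.obj u) (q : (P.F.obj (op u)).obj.obj v),
      ap h ((M.comp N).tmul P (M.tmul N x z) q) = ap k ((M.comp N).tmul P (M.tmul N x z) q)) :
    h = k := by
  apply (P.adj.homEquiv _ _).injective
  refine comp_ext fun s u x z => ?_
  change Γel (M := P) (inj P.F (M.tmul N x z) ≫ h) = Γel (M := P) (inj P.F (M.tmul N x z) ≫ k)
  congr 1
  exact inst_ext fun v q => w s u v x z q

end Elements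

variable {M M' M'' : Bimod R S} {N N' N'' : Bimod S U} {P : Bimod U V}

/-- Horizontal composition of morphisms of bimodules. -/
def compMapNat (θ : M ⟶ M') (φ : N ⟶ N') : (M.comp N).F ⟶ (M'.comp N').F :=
  Functor.whiskerRight θ.nat (Λ N.F) ≫ Functor.whiskerLeft M'.F (ΛMap φ.nat)

lemma compMapNat_tmul (θ : M ⟶ M') (φ : N ⟶ N') {r : Coll R} {s : Coll S} {u : Coll U}
    (x : (M.F.obj (op r)).obj.obj s) (z : (N.F.obj (op s)).obj.obj u) :
    ap ((compMapNat θ φ).app (op r)) (M.tmul N x z) =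
      M'.tmul N' (ap (θ.nat.app (op r)) x) (ap (φ.nat.app (op s)) z) := by
  have : inj N.F x ≫ (Λ N.F).map (θ.nat.app (op r)) ≫ (ΛMap φ.nat).app (M'.F.obj (op r)) =
      φ.nat.app (op s) ≫ inj N'.F (ap (θ.nat.app (op r)) x) := by
    rw [← Category.assoc, inj_map]
    exact inj_desc N.F _ _ _
  exact congrArg (fun g => ap g z) this

/-- Horizontal composition of morphisms of bimodules. -/
def compMap (θ : M ⟶ M') (φ : N ⟶ N') : M.comp N ⟶ M'.comp N' where
  nat := compMapNat θ φ
  nat_ty t := comp_ext fun s u x z => by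
    change (M'.comp N').tyHom (ap ((compMapNat θ φ).app _) (M.tmul N x z)) =
      (M.comp N).tyHom (M.tmul N x z)
    rw [compMapNat_tmul, tyHom_tmul, tyHom_tmul, tyHom_nat]
    rw [bmap_nat, tyHom_nat]

lemma compMap_tmul (θ : M ⟶ M') (φ : N ⟶ N') {r : Coll R} {s : Coll S} {u : Coll U}
    (x : (M.F.obj (op r)).obj.obj s) (z : (N.F.obj (op s)).obj.obj u) :
    ap ((compMap θ φ).nat.app (op r)) (M.tmul N x z) =
      M'.tmul N' (ap (θ.nat.app (op r)) x) (ap (φ.nat.app (op s)) z) :=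
  compMapNat_tmul θ φ x z

section Coherence

variable (M : Bimod R S) (N : Bimod S U) (P : Bimod U V)

/-- The transpose of a component of the associator. -/
def assocAux (r : Coll R) : (M.comp N).F.obj (op r) ⟶ P.Γ.obj ((M.comp (N.comp P)).F.obj (op r)) :=
  desc N.F (fun s x => P.transpose (inj (N.comp P).F x)) (fun s s' f x => by
    rw [← map_inj]
    refine inst_ext fun u z => ?_
    change Γel (M := P) (inj P.F (ap (N.F.map f.op) z) ≫ inj (N.comp P).F x) =
      Γel (M := P) (inj P.F z ≫ (N.comp P).F.map f.op ≫ inj (N.comp P).F x)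
    congr 1
    exact ((Category.assoc _ _ _).symm.trans
      (congrArg (· ≫ inj (N.comp P).F x) (inj_map P.F (N.F.map f.op) z))).symm)

/-- The components of the associator, `(x ⊗ z) ⊗ q ↦ x ⊗ (z ⊗ q)`. -/
def assocHomApp (r : Coll R) :
    ((M.comp N).comp P).F.obj (op r) ⟶ (M.comp (N.comp P)).F.obj (op r) :=
  P.untranspose (assocAux M N P r)

variable {r : Coll R} {s : Coll S} {u : Coll U} {v : Coll V}

lemma assocHomApp_tmul (x : (M.F.obj (op r)).obj.obj s) (z : (N.F.obj (op s)).obj.obj u)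
    (q : (P.F.obj (op u)).obj.obj v) :
    ap (assocHomApp M N P r) ((M.comp N).tmul P (M.tmul N x z) q) =
      M.tmul (N.comp P) x (N.tmul P z q) := by
  have h1 := P.inj_untranspose (assocAux M N P r) (ap (inj N.F x) z)
  have h2 : inj N.F x ≫ assocAux M N P r = P.transpose (inj (N.comp P).F x) := inj_desc N.F _ _ _
  refine (congrArg (fun g => ap g q) h1).trans ?_
  exact congrArg (fun g => ap (Γhom (ap g z)) q) h2

/-- The inverse components of the associator, `x ⊗ (z ⊗ q) ↦ (x ⊗ z) ⊗ q`. -/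
def assocInvApp (r : Coll R) :
    (M.comp (N.comp P)).F.obj (op r) ⟶ ((M.comp N).comp P).F.obj (op r) :=
  desc (N.comp P).F (fun _ x => (Λ P.F).map (inj N.F x)) (fun _ _ f x =>
    ((Λ P.F).map_comp _ _).symm.trans (congrArg (Λ P.F).map (map_inj N.F f x)))

lemma assocInvApp_tmul (x : (M.F.obj (op r)).obj.obj s) (z : (N.F.obj (op s)).obj.obj u)
    (q : (P.F.obj (op u)).obj.obj v) :
    ap (assocInvApp M N P r) (M.tmul (N.comp P) x (N.tmul P z q)) =
      (M.comp N).tmul P (M.tmul N x z) q := by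
  have h1 : inj (N.comp P).F x ≫ assocInvApp M N P r = (Λ P.F).map (inj N.F x) :=
    inj_desc (N.comp P).F _ _ _
  refine (congrArg (fun g => ap g (N.tmul P z q)) h1).trans ?_
  exact congrArg (fun g => ap g q) (inj_map P.F (inj N.F x) z)

variable {M N P} in
lemma comp_ext₃' {J : Inst V} {h k : (M.comp (N.comp P)).F.obj (op r) ⟶ J}
    (w : ∀ (s : Coll S) (u : Coll U) (v : Coll V) (x : (M.F.obj (op r)).obj.obj s)
      (z : (N.F.obj (op s)).obj.obj u) (q : (P.F.obj (op u)).obj.obj v),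
      ap h (M.tmul (N.comp P) x (N.tmul P z q)) = ap k (M.tmul (N.comp P) x (N.tmul P z q))) :
    h = k := by
  refine Λ_ext fun s x => ?_
  refine comp_ext (M := N) (N := P) fun u v z q => ?_
  exact w s u v x z q

/-- The associator. -/
def assoc : (M.comp N).comp P ≅ M.comp (N.comp P) where
  hom :=
    { nat :=
        { app := fun r => assocHomApp M N P r.unop
          naturality := fun r r' f => comp_ext₃ fun s u v x z q => by
            change ap (assocHomApp M N P r'.unop)
                (((M.comp N).comp P).bmap f.unop ((M.comp N).tmul P (M.tmul N x z) q)) =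
              (M.comp (N.comp P)).bmap f.unop (ap (assocHomApp M N P r.unop)
                ((M.comp N).tmul P (M.tmul N x z) q))
            rw [bmap_tmul, bmap_tmul, assocHomApp_tmul, assocHomApp_tmul, bmap_tmul] }
      nat_ty := fun t => comp_ext₃ fun s u v x z q => by
        change (M.comp (N.comp P)).tyHom (ap (assocHomApp M N P (.ty t))
            ((M.comp N).tmul P (M.tmul N x z) q)) =
          ((M.comp N).comp P).tyHom ((M.comp N).tmul P (M.tmul N x z) q)
        rw [assocHomApp_tmul, tyHom_tmul, tyHom_tmul, tyHom_tmul, bmap_tmul, tyHom_tmul] }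
  inv :=
    { nat :=
        { app := fun r => assocInvApp M N P r.unop
          naturality := fun r r' f => comp_ext₃' fun s u v x z q => by
            change ap (assocInvApp M N P r'.unop)
                ((M.comp (N.comp P)).bmap f.unop (M.tmul (N.comp P) x (N.tmul P z q))) =
              ((M.comp N).comp P).bmap f.unop (ap (assocInvApp M N P r.unop)
                (M.tmul (N.comp P) x (N.tmul P z q)))
            rw [bmap_tmul, assocInvApp_tmul, assocInvApp_tmul, bmap_tmul, bmap_tmul] }
      nat_ty := fun t => comp_ext₃' fun s u v x z q => by
        change ((M.comp N).comp P).tyHom (ap (assocInvApp M N P (.ty t))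
            (M.tmul (N.comp P) x (N.tmul P z q))) =
          (M.comp (N.comp P)).tyHom (M.tmul (N.comp P) x (N.tmul P z q))
        rw [assocInvApp_tmul, tyHom_tmul, tyHom_tmul, tyHom_tmul, bmap_tmul, tyHom_tmul] }
  hom_inv_id := hom_ext fun r => comp_ext₃ fun s u v x z q => by
    change ap (assocInvApp M N P r) (ap (assocHomApp M N P r) _) = _
    rw [assocHomApp_tmul, assocInvApp_tmul]
    rfl
  inv_hom_id := hom_ext fun r => comp_ext₃' fun s u v x z q => by
    change ap (assocHomApp M N P r) (ap (assocInvApp M N P r) _) = _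
    rw [assocInvApp_tmul, assocHomApp_tmul]
    rfl

lemma assoc_hom_tmul (x : (M.F.obj (op r)).obj.obj s) (z : (N.F.obj (op s)).obj.obj u)
    (q : (P.F.obj (op u)).obj.obj v) :
    ap ((assoc M N P).hom.nat.app (op r)) ((M.comp N).tmul P (M.tmul N x z) q) =
      M.tmul (N.comp P) x (N.tmul P z q) := assocHomApp_tmul M N P x z q

/-- An element of the unit bimodule. -/
def unitEl {r r' : Coll R} (f : r ⟶ r') : ((unit R).F.obj (op r)).obj.obj r' := ofHom f

lemma leftUnitorApp_tmul {r r' : Coll R} (f : r ⟶ r') (x : (M.F.obj (op r')).obj.obj s) :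
    ap (ΛyIso M.F r).hom ((unit R).tmul M (unitEl f) x) = M.bmap f x :=
  congrArg (fun g => ap g x) (inj_ΛyIso M.F f)

/-- The left unitor. -/
def leftUnitor : (unit R).comp M ≅ M where
  hom :=
    { nat :=
        { app := fun r => (ΛyIso M.F r.unop).hom
          naturality := fun r r' f => ΛyIso_nat M.F f.unop }
      nat_ty := fun t => comp_ext fun r s f x => by
        change M.tyHom (ap (ΛyIso M.F (.ty t)).hom ((unit R).tmul M (unitEl (toHom f)) x)) =
          ((unit R).comp M).tyHom ((unit R).tmul M (unitEl (toHom f)) x)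
        rw [leftUnitorApp_tmul, tyHom_tmul]
        rfl }
  inv :=
    { nat :=
        { app := fun r => (ΛyIso M.F r.unop).inv
          naturality := fun r r' f => inst_ext fun s x => by
            change (unit R).tmul M (unitEl (𝟙 r'.unop)) (M.bmap f.unop x) =
              ((unit R).comp M).bmap f.unop ((unit R).tmul M (unitEl (𝟙 r.unop)) x)
            rw [bmap_tmul, tmul_bmap]
            congr 1
            exact (Category.id_comp f.unop).trans (Category.comp_id f.unop).symm }
      nat_ty := fun t => inst_ext fun s x => by
        change ((unit R).comp M).tyHom ((unit R).tmul M (unitEl (𝟙 _)) x) = M.tyHom x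
        rw [tyHom_tmul]
        exact congrArg M.tyHom (M.bmap_id x) }
  hom_inv_id := hom_ext fun r => (ΛyIso M.F r).hom_inv_id
  inv_hom_id := hom_ext fun r => (ΛyIso M.F r).inv_hom_id

lemma leftUnitor_hom_tmul {r r' : Coll R} (f : r ⟶ r') (x : (M.F.obj (op r')).obj.obj s) :
    ap ((leftUnitor M).hom.nat.app (op r)) ((unit R).tmul M (unitEl f) x) = M.bmap f x :=
  leftUnitorApp_tmul M f x

lemma leftUnitor_inv_ap {r : Coll R} (x : (M.F.obj (op r)).obj.obj s) :
    ap ((leftUnitor M).inv.nat.app (op r)) x = (unit R).tmul M (unitEl (𝟙 r)) x := rfl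

/-- The components of the right unitor. -/
def rightUnitorApp (r : Coll R) : (M.comp (unit S)).F.obj (op r) ⟶ M.F.obj (op r) :=
  desc (y S) (fun _ x => el x) (fun _ _ f x => y_map_el f x)

lemma rightUnitorApp_tmul {s' : Coll S} (x : (M.F.obj (op r)).obj.obj s) (f : s ⟶ s') :
    ap (rightUnitorApp M r) (M.tmul (unit S) x (unitEl f)) = act f x :=
  congrArg (fun g => ap g (ofHom f)) (inj_desc (y S) _ _ _)

lemma tmul_unitEl {s' : Coll S} (x : (M.F.obj (op r)).obj.obj s) (f : s ⟶ s') :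
    M.tmul (unit S) x (unitEl f) = M.tmul (unit S) (act f x) (unitEl (𝟙 s')) := by
  rw [← tmul_bmap]
  congr 1
  exact (Category.comp_id f).symm

/-- The right unitor. -/
def rightUnitor : M.comp (unit S) ≅ M where
  hom :=
    { nat :=
        { app := fun r => rightUnitorApp M r.unop
          naturality := fun r r' f => comp_ext fun s s' x g => by
            change ap (rightUnitorApp M r'.unop)
                ((M.comp (unit S)).bmap f.unop (M.tmul (unit S) x (unitEl (toHom g)))) =
              M.bmap f.unop (ap (rightUnitorApp M r.unop) (M.tmul (unit S) x (unitEl (toHom g))))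
            rw [bmap_tmul, rightUnitorApp_tmul, rightUnitorApp_tmul, bmap_act] }
      nat_ty := fun t => comp_ext fun s s' x g => by
        change M.tyHom (ap (rightUnitorApp M (.ty t)) (M.tmul (unit S) x (unitEl (toHom g)))) =
          (M.comp (unit S)).tyHom (M.tmul (unit S) x (unitEl (toHom g)))
        rw [rightUnitorApp_tmul, tyHom_act, tyHom_tmul]
        rfl }
  inv :=
    { nat :=
        { app := fun r => ObjectProperty.homMk
            { app := fun s => ↾fun x => M.tmul (unit S) x (unitEl (𝟙 s))
              naturality := fun s s' f => by
                refine ConcreteCategory.hom_ext _ _ fun x => ?_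
                change M.tmul (unit S) (act f x) (unitEl (𝟙 s')) =
                  act f (M.tmul (unit S) x (unitEl (𝟙 s)))
                rw [tmul_act, ← tmul_unitEl]
                congr 1
                exact (Category.id_comp f).symm }
          naturality := fun r r' f => inst_ext fun s x => by
            change M.tmul (unit S) (M.bmap f.unop x) (unitEl (𝟙 s)) =
              (M.comp (unit S)).bmap f.unop (M.tmul (unit S) x (unitEl (𝟙 s)))
            rw [bmap_tmul] }
      nat_ty := fun t => inst_ext fun s x => by
        change (M.comp (unit S)).tyHom (M.tmul (unit S) x (unitEl (𝟙 s))) = M.tyHom x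
        rw [tyHom_tmul]
        exact Category.comp_id (M.tyHom x) }
  hom_inv_id := hom_ext fun r => comp_ext fun s s' x g => by
    change M.tmul (unit S) (ap (rightUnitorApp M r) (M.tmul (unit S) x (unitEl (toHom g))))
      (unitEl (𝟙 s')) = M.tmul (unit S) x (unitEl (toHom g))
    rw [rightUnitorApp_tmul, ← tmul_unitEl]
  inv_hom_id := hom_ext fun r => inst_ext fun s x => by
    change ap (rightUnitorApp M r) (M.tmul (unit S) x (unitEl (𝟙 s))) = x
    rw [rightUnitorApp_tmul, act_id]

lemma rightUnitor_hom_tmul {s' : Coll S} (x : (M.F.obj (op r)).obj.obj s) (f : s ⟶ s') :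
    ap ((rightUnitor M).hom.nat.app (op r)) (M.tmul (unit S) x (unitEl f)) = act f x :=
  rightUnitorApp_tmul M x f

end Coherence

end Bimod

end AlgData

end

noncomputable section

namespace AlgData

variable {T : Type u} [SmallCategory T] {R R' R'' S S' S'' U U' U'' V V' : Schema T}

lemma Coll.mapId_obj (a : Coll S) : (Coll.map (𝟙 S)).obj a = a := by cases a <;> rfl

lemma Coll.mapComp_obj (F : R ⟶ S) (G : S ⟶ U) (a : Coll R) :
    (Coll.map (F ≫ G)).obj a = (Coll.map G).obj ((Coll.map F).obj a) := by cases a <;> rfl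

/-- Restriction along the identity. -/
def Δid (S : Schema T) : 𝟭 (Inst S) ⟶ Δ (𝟙 S) where
  app I := ObjectProperty.homMk (Functor.whiskerRight (Coll.mapId S).inv I.obj)
  naturality _ _ h := inst_ext fun s x => (ap_act h ((Coll.mapId S).inv.app s) x).symm

/-- Restriction along a composite. -/
def Δcomp (F : R ⟶ S) (G : S ⟶ U) : Δ G ⋙ Δ F ⟶ Δ (F ≫ G) where
  app I := ObjectProperty.homMk (Functor.whiskerRight (Coll.mapComp F G).inv I.obj)
  naturality _ _ h := inst_ext fun s x => (ap_act h ((Coll.mapComp F G).inv.app s) x).symm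

/-- Restriction along a schema mapping preserves the instances represented by types. -/
def tyΔ (G : S ⟶ S') (t : T) :
    (y S).obj (op (.ty t)) ≅ (Δ G).obj ((y S').obj (op (.ty t))) :=
  ObjectProperty.isoMk _ (NatIso.ofComponents
    (fun s => match s with
      | .ent _ => { hom := ↾fun f => PEmpty.elim f, inv := ↾fun f => PEmpty.elim f,
                    hom_inv_id := by ext f; exact PEmpty.elim f
                    inv_hom_id := by ext f; exact PEmpty.elim f }
      | .ty t' => Iso.refl (t ⟶ t'))
    (fun {s s'} f => by
      refine ConcreteCategory.hom_ext _ _ fun x => ?_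
      cases s with
      | ent e => exact PEmpty.elim x
      | ty t₁ =>
        cases s' with
        | ent e => exact PEmpty.elim f
        | ty t₂ => rfl))

lemma toHom_tyΔ (G : S ⟶ S') {t : T} {s : Coll S} (f : Coll.ty t ⟶ s) :
    toHom (S := S') (s := .ty t) (s' := (Coll.map G).obj s) (ap (tyΔ G t).hom (ofHom f) :) =
      (Coll.map G).map f := by
  cases s with
  | ent e => exact PEmpty.elim f
  | ty t' => rfl

/-- A 2-cell with top `M`, bottom `M'`, left side `F` and right side `G`: a natural transformation
from `M` to `Δ_G ∘ M' ∘ F` which restricts to the identity on types. -/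
@[ext]
structure Cell (F : R ⟶ R') (G : S ⟶ S') (M : Bimod R S) (M' : Bimod R' S') where
  nat : M.F ⟶ (Coll.map F).op ⋙ M'.F ⋙ Δ G
  nat_ty (t : T) : nat.app (op (.ty t)) ≫ (Δ G).map (M'.tyIso t).hom =
    (M.tyIso t).hom ≫ (tyΔ G t).hom

namespace Cell

section Elements

variable {F : R ⟶ R'} {G : S ⟶ S'} {M : Bimod R S} {M' : Bimod R' S'} {r r₁ : Coll R}
  {s s₁ : Coll S}

/-- The action of a 2-cell on elements. -/
def fn (θ : Cell F G M M') (x : (M.F.obj (op r)).obj.obj s) :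
    (M'.F.obj (op ((Coll.map F).obj r))).obj.obj ((Coll.map G).obj s) :=
  (ap (θ.nat.app (op r)) x :)

lemma fn_act (θ : Cell F G M M') (x : (M.F.obj (op r)).obj.obj s) (g : s ⟶ s₁) :
    θ.fn (act g x) = act ((Coll.map G).map g) (θ.fn x) :=
  ap_act (θ.nat.app (op r)) g x

lemma fn_bmap (θ : Cell F G M M') (x : (M.F.obj (op r)).obj.obj s) (f : r₁ ⟶ r) :
    θ.fn (M.bmap f x) = M'.bmap ((Coll.map F).map f) (θ.fn x) :=
  congrArg (fun k => ap k x) (θ.nat.naturality f.op)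

lemma nat_ty_iff (n : M.F ⟶ (Coll.map F).op ⋙ M'.F ⋙ Δ G) (t : T)
    (x : (M.F.obj (op (.ty t))).obj.obj s) :
    ap (n.app (op (.ty t)) ≫ (Δ G).map (M'.tyIso t).hom) x =
      ap ((M.tyIso t).hom ≫ (tyΔ G t).hom) x ↔
    M'.tyHom (t := t) (s := (Coll.map G).obj s) (ap (n.app (op (.ty t))) x :) =
      (Coll.map G).map (M.tyHom x) := by
  have h := toHom_tyΔ G (M.tyHom x)
  rw [← h]
  exact Iff.rfl

lemma tyHom_fn (θ : Cell F G M M') {t : T} (x : (M.F.obj (op (.ty t))).obj.obj s) :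
    M'.tyHom (t := t) (s := (Coll.map G).obj s) (θ.fn x) = (Coll.map G).map (M.tyHom x) :=
  (nat_ty_iff θ.nat t x).1 (congrArg (fun k => ap k x) (θ.nat_ty t))

lemma ext_fn {θ θ' : Cell F G M M'}
    (w : ∀ (r : Coll R) (s : Coll S) (x : (M.F.obj (op r)).obj.obj s), θ.fn x = θ'.fn x) :
    θ = θ' :=
  Cell.ext (NatTrans.ext (funext fun r => inst_ext fun s x => w r.unop s x))

lemma fn_heq (θ : Cell F G M M') {x : (M.F.obj (op r)).obj.obj s}
    {x₁ : (M.F.obj (op r₁)).obj.obj s₁} (hr : r = r₁) (hs : s = s₁) (hx : HEq x x₁) :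
    HEq (θ.fn x) (θ.fn x₁) := by
  subst hr hs
  cases hx
  rfl

lemma heq_of_fn {F₁ : R ⟶ R'} {G₁ : S ⟶ S'} {θ : Cell F G M M'} {θ₁ : Cell F₁ G₁ M M'}
    (hF : F = F₁) (hG : G = G₁)
    (w : ∀ (r : Coll R) (s : Coll S) (x : (M.F.obj (op r)).obj.obj s), HEq (θ.fn x) (θ₁.fn x)) :
    HEq θ θ₁ := by
  subst hF hG
  exact heq_of_eq (ext_fn fun r s x => eq_of_heq (w r s x))

end Elements

/-- The 2-cell with identity vertical sides given by a morphism of bimodules. -/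
def ofHom {M N : Bimod R S} (α : M ⟶ N) : Cell (𝟙 R) (𝟙 S) M N where
  nat := α.nat ≫ Functor.whiskerLeft N.F (Δid S) ≫
    Functor.whiskerRight (NatTrans.op (Coll.mapId R).hom) (N.F ⋙ Δ (𝟙 S))
  nat_ty t := inst_ext fun s x => (nat_ty_iff _ t x).2 (by
    change N.tyHom (N.bmap (𝟙 (Coll.ty t)) (act ((Coll.mapId S).inv.app s)
      (ap (α.nat.app (op (.ty t))) x))) = (Coll.map (𝟙 S)).map (M.tyHom x)
    rw [Bimod.bmap_id, Bimod.tyHom_act, Bimod.tyHom_nat]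
    exact ((Coll.mapId S).inv.naturality (M.tyHom x)).trans (Category.id_comp _))

lemma ofHom_fn {M N : Bimod R S} (α : M ⟶ N) {r : Coll R} {s : Coll S}
    (x : (M.F.obj (op r)).obj.obj s) : HEq ((ofHom α).fn x) (ap (α.nat.app (op r)) x) := by
  have key : (ofHom α).fn x = N.bmap ((Coll.mapId R).hom.app r) (act ((Coll.mapId S).inv.app s)
    (ap (α.nat.app (op r)) x)) := rfl
  rw [key]
  cases r <;> cases s <;> exact heq_of_eq ((N.bmap_id _).trans (act_id _))

/-- The vertical composite of 2-cells. -/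
def vComp {F : R ⟶ R'} {G : S ⟶ S'} {F' : R' ⟶ R''} {G' : S' ⟶ S''} {M : Bimod R S}
    {M' : Bimod R' S'} {M'' : Bimod R'' S''} (θ : Cell F G M M') (θ' : Cell F' G' M' M'') :
    Cell (F ≫ F') (G ≫ G') M M'' where
  nat := θ.nat ≫ Functor.whiskerLeft (Coll.map F).op (Functor.whiskerRight θ'.nat (Δ G)) ≫
    Functor.whiskerLeft ((Coll.map F).op ⋙ (Coll.map F').op ⋙ M''.F) (Δcomp G G') ≫
    Functor.whiskerRight (NatTrans.op (Coll.mapComp F F').hom) (M''.F ⋙ Δ (G ≫ G'))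
  nat_ty t := inst_ext fun s x => (nat_ty_iff _ t x).2 (by
    change M''.tyHom (M''.bmap (𝟙 (Coll.ty t)) (act ((Coll.mapComp G G').inv.app s)
      (θ'.fn (θ.fn x)))) = (Coll.map (G ≫ G')).map (M.tyHom x)
    rw [Bimod.bmap_id]
    refine (M''.tyHom_act (t := t) (θ'.fn (θ.fn x)) ((Coll.mapComp G G').inv.app s)).trans ?_
    refine (congrArg (· ≫ (Coll.mapComp G G').inv.app s) (tyHom_fn θ' (t := t) (θ.fn x))).trans ?_
    refine (congrArg (fun k => (Coll.map G').map k ≫ (Coll.mapComp G G').inv.app s)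
      (tyHom_fn θ x)).trans ?_
    exact ((Coll.mapComp G G').inv.naturality (M.tyHom x)).trans (Category.id_comp _))

lemma vComp_fn {F : R ⟶ R'} {G : S ⟶ S'} {F' : R' ⟶ R''} {G' : S' ⟶ S''} {M : Bimod R S}
    {M' : Bimod R' S'} {M'' : Bimod R'' S''} (θ : Cell F G M M') (θ' : Cell F' G' M' M'')
    {r : Coll R} {s : Coll S} (x : (M.F.obj (op r)).obj.obj s) :
    HEq ((vComp θ θ').fn x) (θ'.fn (θ.fn x)) := by
  have key : (vComp θ θ').fn x = M''.bmap ((Coll.mapComp F F').hom.app r)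
    (act ((Coll.mapComp G G').inv.app s) (θ'.fn (θ.fn x))) := rfl
  rw [key]
  cases r <;> cases s <;> exact heq_of_eq ((M''.bmap_id _).trans (act_id _))

/-- The unit 2-cell of a schema mapping. -/
def unit (F : R ⟶ R') : Cell F F (Bimod.unit R) (Bimod.unit R') where
  nat :=
    { app := fun r => ObjectProperty.homMk
        { app := fun s => ↾fun f => (Coll.map F).map (toHom f)
          naturality := fun s s' g => by
            refine ConcreteCategory.hom_ext _ _ fun f => ?_
            exact (Coll.map F).map_comp (toHom f) g }
      naturality := fun r r' g => inst_ext fun s f => (Coll.map F).map_comp g.unop (toHom f) }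
  nat_ty t := inst_ext fun s x => (nat_ty_iff _ t x).2 rfl

lemma unit_fn (F : R ⟶ R') {r s : Coll R} (f : r ⟶ s) :
    (unit F).fn (Bimod.unitEl f) = Bimod.unitEl ((Coll.map F).map f) := rfl

section Horizontal

variable [HasFiniteProducts T] {F : R ⟶ R'} {G : S ⟶ S'} {H : U ⟶ U'} {M : Bimod R S}
  {M' : Bimod R' S'} {N : Bimod S U} {N' : Bimod S' U'}

/-- The comparison `Λ_N ∘ Δ_G ⟶ Δ_H ∘ Λ_{N'}` induced by a 2-cell; it is the mate of
`Λ_N ⟶ Δ_H ∘ Λ_{N'} ∘ Σ_G`. -/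
def ΛΔ (φ : Cell G H N N') : Δ G ⋙ Λ N.F ⟶ Λ N'.F ⋙ Δ H where
  app I := desc N.F
    (fun s x => φ.nat.app (op s) ≫ (Δ H).map (inj N'.F (r := (Coll.map G).obj s) x))
    (fun s s' f x => inst_ext fun u z => by
      change ap (inj N'.F (r := (Coll.map G).obj s) x) (φ.fn (N.bmap f z)) =
        ap (inj N'.F (act (I := I) ((Coll.map G).map f) x)) (φ.fn z)
      rw [fn_bmap]
      exact congrArg (fun k => ap k (φ.fn z))
        (map_inj N'.F (I := I) (r := (Coll.map G).obj s) ((Coll.map G).map f) x))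
  naturality I J h := Λ_ext fun s x => by
    refine ((Category.assoc _ _ _).symm.trans (congrArg (· ≫ _) (inj_map N.F _ x))).trans ?_
    refine (inj_desc N.F _ _ _).trans ?_
    refine Eq.trans ?_ (Category.assoc _ _ _)
    refine Eq.trans ?_ (congrArg (· ≫ _) (inj_desc N.F _ _ x).symm)
    refine Eq.trans ?_ (Category.assoc _ _ _).symm
    refine congrArg (φ.nat.app (op s) ≫ ·) ?_
    exact (congrArg (Δ H).map (inj_map N'.F (r := (Coll.map G).obj s) h x).symm).trans
      ((Δ H).map_comp _ _)

/-- The horizontal composite of 2-cells. -/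
def hCompNat (θ : Cell F G M M') (φ : Cell G H N N') :
    (M.comp N).F ⟶ (Coll.map F).op ⋙ (M'.comp N').F ⋙ Δ H :=
  Functor.whiskerRight θ.nat (Λ N.F) ≫ Functor.whiskerLeft ((Coll.map F).op ⋙ M'.F) (ΛΔ φ)

lemma hCompNat_tmul (θ : Cell F G M M') (φ : Cell G H N N') {r : Coll R} {s : Coll S} {u : Coll U}
    (x : (M.F.obj (op r)).obj.obj s) (z : (N.F.obj (op s)).obj.obj u) :
    (ap ((hCompNat θ φ).app (op r)) (M.tmul N x z) :) = M'.tmul N' (θ.fn x) (φ.fn z) := by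
  have : inj N.F x ≫ (Λ N.F).map (θ.nat.app (op r)) ≫ (ΛΔ φ).app (M'.F.obj _) =
      φ.nat.app (op s) ≫ (Δ H).map (inj N'.F (θ.fn x)) := by
    rw [← Category.assoc, inj_map]
    exact inj_desc N.F _ _ _
  exact congrArg (fun g => ap g z) this

/-- The horizontal composite of 2-cells. -/
def hComp (θ : Cell F G M M') (φ : Cell G H N N') : Cell F H (M.comp N) (M'.comp N') where
  nat := hCompNat θ φ
  nat_ty t := Bimod.comp_ext fun s u x z => (nat_ty_iff _ t _).2 (by
    refine (congrArg ((M'.comp N').tyHom (t := t)) (hCompNat_tmul θ φ x z)).trans ?_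
    refine (Bimod.tyHom_tmul M' N' (t := t) (θ.fn x) (φ.fn z)).trans ?_
    rw [Bimod.tyHom_tmul, ← tyHom_fn, fn_bmap]
    exact congrArg (fun k => N'.tyHom (t := t) (N'.bmap k (φ.fn z))) (tyHom_fn θ x))

lemma hComp_fn (θ : Cell F G M M') (φ : Cell G H N N') {r : Coll R} {s : Coll S} {u : Coll U}
    (x : (M.F.obj (op r)).obj.obj s) (z : (N.F.obj (op s)).obj.obj u) :
    (hComp θ φ).fn (M.tmul N x z) = M'.tmul N' (θ.fn x) (φ.fn z) := hCompNat_tmul θ φ x z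

end Horizontal

end Cell

end AlgData

end

noncomputable section

namespace AlgData

/-- A (pseudo) double category: objects, vertical morphisms (forming a category), horizontal
morphisms, and 2-cells, with strictly associative vertical composition and horizontal composition
which is associative and unital up to coherent globular isomorphism. The equations between 2-cells
whose vertical sides are equal but not syntactically so are stated with `HEq`. -/
structure DoubleCategory where
  Obj : Type u₁
  [vert : Category.{v₁} Obj]
  Hor : Obj → Obj → Type u₂
  Cell {a b a' b' : Obj} : (a ⟶ a') → (b ⟶ b') → Hor a b → Hor a' b' → Type v₂
  vId {a b : Obj} (M : Hor a b) : Cell (𝟙 a) (𝟙 b) M M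
  vComp {a b a' b' a'' b'' : Obj} {f : a ⟶ a'} {g : b ⟶ b'} {f' : a' ⟶ a''} {g' : b' ⟶ b''}
    {M : Hor a b} {M' : Hor a' b'} {M'' : Hor a'' b''} :
    Cell f g M M' → Cell f' g' M' M'' → Cell (f ≫ f') (g ≫ g') M M''
  vId_vComp {a b a' b' : Obj} {f : a ⟶ a'} {g : b ⟶ b'} {M : Hor a b} {M' : Hor a' b'}
    (θ : Cell f g M M') : HEq (vComp (vId M) θ) θ
  vComp_vId {a b a' b' : Obj} {f : a ⟶ a'} {g : b ⟶ b'} {M : Hor a b} {M' : Hor a' b'}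
    (θ : Cell f g M M') : HEq (vComp θ (vId M')) θ
  vComp_assoc {a b a' b' a'' b'' a₃ b₃ : Obj} {f : a ⟶ a'} {g : b ⟶ b'} {f' : a' ⟶ a''}
    {g' : b' ⟶ b''} {f'' : a'' ⟶ a₃} {g'' : b'' ⟶ b₃} {M : Hor a b} {M' : Hor a' b'}
    {M'' : Hor a'' b''} {M₃ : Hor a₃ b₃} (θ : Cell f g M M') (θ' : Cell f' g' M' M'')
    (θ'' : Cell f'' g'' M'' M₃) : HEq (vComp (vComp θ θ') θ'') (vComp θ (vComp θ' θ''))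
  hId (a : Obj) : Hor a a
  hIdCell {a a' : Obj} (f : a ⟶ a') : Cell f f (hId a) (hId a')
  hIdCell_id (a : Obj) : hIdCell (𝟙 a) = vId (hId a)
  hIdCell_comp {a a' a'' : Obj} (f : a ⟶ a') (f' : a' ⟶ a'') :
    hIdCell (f ≫ f') = vComp (hIdCell f) (hIdCell f')
  hComp {a b c : Obj} : Hor a b → Hor b c → Hor a c
  hCompCell {a b c a' b' c' : Obj} {f : a ⟶ a'} {g : b ⟶ b'} {h : c ⟶ c'} {M : Hor a b}
    {N : Hor b c} {M' : Hor a' b'} {N' : Hor b' c'} :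
    Cell f g M M' → Cell g h N N' → Cell f h (hComp M N) (hComp M' N')
  hCompCell_vId {a b c : Obj} (M : Hor a b) (N : Hor b c) :
    hCompCell (vId M) (vId N) = vId (hComp M N)
  hCompCell_vComp {a b c a' b' c' a'' b'' c'' : Obj} {f : a ⟶ a'} {g : b ⟶ b'} {h : c ⟶ c'}
    {f' : a' ⟶ a''} {g' : b' ⟶ b''} {h' : c' ⟶ c''} {M : Hor a b} {N : Hor b c} {M' : Hor a' b'}
    {N' : Hor b' c'} {M'' : Hor a'' b''} {N'' : Hor b'' c''} (θ : Cell f g M M')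
    (φ : Cell g h N N') (θ' : Cell f' g' M' M'') (φ' : Cell g' h' N' N'') :
    hCompCell (vComp θ θ') (vComp φ φ') = vComp (hCompCell θ φ) (hCompCell θ' φ')
  assocHom {a b c d : Obj} (M : Hor a b) (N : Hor b c) (P : Hor c d) :
    Cell (𝟙 a) (𝟙 d) (hComp (hComp M N) P) (hComp M (hComp N P))
  assocInv {a b c d : Obj} (M : Hor a b) (N : Hor b c) (P : Hor c d) :
    Cell (𝟙 a) (𝟙 d) (hComp M (hComp N P)) (hComp (hComp M N) P)
  assocHom_assocInv {a b c d : Obj} (M : Hor a b) (N : Hor b c) (P : Hor c d) :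
    HEq (vComp (assocHom M N P) (assocInv M N P)) (vId (hComp (hComp M N) P))
  assocInv_assocHom {a b c d : Obj} (M : Hor a b) (N : Hor b c) (P : Hor c d) :
    HEq (vComp (assocInv M N P) (assocHom M N P)) (vId (hComp M (hComp N P)))
  assocHom_naturality {a b c d a' b' c' d' : Obj} {f : a ⟶ a'} {g : b ⟶ b'} {h : c ⟶ c'}
    {k : d ⟶ d'} {M : Hor a b} {N : Hor b c} {P : Hor c d} {M' : Hor a' b'} {N' : Hor b' c'}
    {P' : Hor c' d'} (θ : Cell f g M M') (φ : Cell g h N N') (ψ : Cell h k P P') :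
    HEq (vComp (hCompCell (hCompCell θ φ) ψ) (assocHom M' N' P'))
      (vComp (assocHom M N P) (hCompCell θ (hCompCell φ ψ)))
  leftUnitorHom {a b : Obj} (M : Hor a b) : Cell (𝟙 a) (𝟙 b) (hComp (hId a) M) M
  leftUnitorInv {a b : Obj} (M : Hor a b) : Cell (𝟙 a) (𝟙 b) M (hComp (hId a) M)
  leftUnitorHom_leftUnitorInv {a b : Obj} (M : Hor a b) :
    HEq (vComp (leftUnitorHom M) (leftUnitorInv M)) (vId (hComp (hId a) M))
  leftUnitorInv_leftUnitorHom {a b : Obj} (M : Hor a b) :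
    HEq (vComp (leftUnitorInv M) (leftUnitorHom M)) (vId M)
  leftUnitorHom_naturality {a b a' b' : Obj} {f : a ⟶ a'} {g : b ⟶ b'} {M : Hor a b}
    {M' : Hor a' b'} (θ : Cell f g M M') :
    HEq (vComp (hCompCell (hIdCell f) θ) (leftUnitorHom M')) (vComp (leftUnitorHom M) θ)
  rightUnitorHom {a b : Obj} (M : Hor a b) : Cell (𝟙 a) (𝟙 b) (hComp M (hId b)) M
  rightUnitorInv {a b : Obj} (M : Hor a b) : Cell (𝟙 a) (𝟙 b) M (hComp M (hId b))
  rightUnitorHom_rightUnitorInv {a b : Obj} (M : Hor a b) :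
    HEq (vComp (rightUnitorHom M) (rightUnitorInv M)) (vId (hComp M (hId b)))
  rightUnitorInv_rightUnitorHom {a b : Obj} (M : Hor a b) :
    HEq (vComp (rightUnitorInv M) (rightUnitorHom M)) (vId M)
  rightUnitorHom_naturality {a b a' b' : Obj} {f : a ⟶ a'} {g : b ⟶ b'} {M : Hor a b}
    {M' : Hor a' b'} (θ : Cell f g M M') :
    HEq (vComp (hCompCell θ (hIdCell g)) (rightUnitorHom M')) (vComp (rightUnitorHom M) θ)
  pentagon {a b c d e : Obj} (M : Hor a b) (N : Hor b c) (P : Hor c d) (Q : Hor d e) :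
    HEq (vComp (vComp (hCompCell (assocHom M N P) (vId Q)) (assocHom M (hComp N P) Q))
        (hCompCell (vId M) (assocHom N P Q)))
      (vComp (assocHom (hComp M N) P Q) (assocHom M N (hComp P Q)))
  triangle {a b c : Obj} (M : Hor a b) (N : Hor b c) :
    HEq (vComp (assocHom M (hId b) N) (hCompCell (vId M) (leftUnitorHom N)))
      (hCompCell (rightUnitorHom M) (vId N))

attribute [instance] DoubleCategory.vert

/-- An equipment: a double category in which every niche has a cartesian filler. -/
structure Equipment extends DoubleCategory.{v₁, v₂, u₁, u₂} where
  restr {a b a' b' : Obj} (f : a ⟶ a') (g : b ⟶ b') (N : Hor a' b') : Hor a b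
  cart {a b a' b' : Obj} (f : a ⟶ a') (g : b ⟶ b') (N : Hor a' b') : Cell f g (restr f g N) N
  cart_universal {a b a' b' x y : Obj} (f : a ⟶ a') (g : b ⟶ b') (N : Hor a' b') (h : x ⟶ a)
    (k : y ⟶ b) (M : Hor x y) (θ : Cell (h ≫ f) (k ≫ g) M N) :
    ∃! θ' : Cell h k M (restr f g N), vComp θ' (cart f g N) = θ

/-- `H`, with the globular 2-cell `ε : H ⊙ N ⇒ P`, is a right hom `N ▷ P`: every 2-cell
`M ⊙ N ⇒ P` with right side an identity factors uniquely through `ε`. -/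
def DoubleCategory.IsRightHom (D : DoubleCategory.{v₁, v₂, u₁, u₂}) {a b c : D.Obj} (N : D.Hor b c)
    (P : D.Hor a c) (H : D.Hor a b) (ε : D.Cell (𝟙 a) (𝟙 c) (D.hComp H N) P) : Prop :=
  ∀ {x : D.Obj} (f : x ⟶ a) (M : D.Hor x b) (θ : D.Cell f (𝟙 c) (D.hComp M N) P),
    ∃! θ' : D.Cell f (𝟙 b) M H, HEq (D.vComp (D.hCompCell θ' (D.vId N)) ε) θ

/-- An equipment is right closed if all right homs exist. -/
def Equipment.IsRightClosed (D : Equipment.{v₁, v₂, u₁, u₂}) : Prop :=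
  ∀ {a b c : D.Obj} (N : D.Hor b c) (P : D.Hor a c),
    ∃ (H : D.Hor a b) (ε : D.Cell (𝟙 a) (𝟙 c) (D.hComp H N) P), D.IsRightHom N P H ε

variable {T : Type u} [SmallCategory T] {R R' R'' S S' S'' U U' U'' V V' W : Schema T}

lemma tyΔ_nat (G : S ⟶ S') {t t' : T} (f : t ⟶ t') :
    (y S).map (Coll.tyHom S f).op ≫ (tyΔ G t).hom =
      (tyΔ G t').hom ≫ (Δ G).map ((y S').map (Coll.tyHom S' f).op) :=
  inst_ext fun s x => by
    cases s with
    | ent e => exact PEmpty.elim x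
    | ty t₁ => rfl

namespace Bimod

/-- The restriction of a bimodule along schema mappings on both sides. -/
def restr (F : R ⟶ R') (G : S ⟶ S') (N : Bimod R' S') : Bimod R S where
  F := (Coll.map F).op ⋙ N.F ⋙ Δ G
  tyIso t := (Δ G).mapIso (N.tyIso t) ≪≫ (tyΔ G t).symm
  tyIso_nat {t t'} f := by
    change (Δ G).map (N.F.map (Coll.tyHom R' f).op) ≫ (Δ G).map (N.tyIso t).hom ≫ (tyΔ G t).inv =
      ((Δ G).map (N.tyIso t').hom ≫ (tyΔ G t').inv) ≫ (y S).map (Coll.tyHom S f).op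
    rw [← Category.assoc, ← Functor.map_comp, N.tyIso_nat, Functor.map_comp, Iso.comp_inv_eq,
      Category.assoc, Category.assoc, tyΔ_nat, Iso.inv_hom_id_assoc]

end Bimod

namespace Cell

/-- The cartesian 2-cell of a restriction. -/
def cart (F : R ⟶ R') (G : S ⟶ S') (N : Bimod R' S') : Cell F G (Bimod.restr F G N) N where
  nat := 𝟙 _
  nat_ty t := by
    change 𝟙 _ ≫ (Δ G).map (N.tyIso t).hom =
      ((Δ G).map (N.tyIso t).hom ≫ (tyΔ G t).inv) ≫ (tyΔ G t).hom
    rw [Category.assoc, Iso.inv_hom_id, Category.comp_id]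
    exact Category.id_comp _

section

variable [HasFiniteProducts T]

lemma tmul_heq (M : Bimod R S) (N : Bimod S U) {r r₁ : Coll R} {s s₁ : Coll S} {u u₁ : Coll U}
    {x : (M.F.obj (op r)).obj.obj s} {x₁ : (M.F.obj (op r₁)).obj.obj s₁}
    {z : (N.F.obj (op s)).obj.obj u} {z₁ : (N.F.obj (op s₁)).obj.obj u₁}
    (hr : r = r₁) (hs : s = s₁) (hu : u = u₁) (hx : HEq x x₁) (hz : HEq z z₁) :
    HEq (M.tmul N x z) (M.tmul N x₁ z₁) := by
  subst hr hs hu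
  cases hx
  cases hz
  rfl

lemma ap_nat_heq {M N : Bimod R S} (α : M ⟶ N) {r r₁ : Coll R} {s s₁ : Coll S}
    {x : (M.F.obj (op r)).obj.obj s} {x₁ : (M.F.obj (op r₁)).obj.obj s₁}
    (hr : r = r₁) (hs : s = s₁) (hx : HEq x x₁) :
    HEq (ap (α.nat.app (op r)) x) (ap (α.nat.app (op r₁)) x₁) := by
  subst hr hs
  cases hx
  rfl

section

variable {F F₁ : R ⟶ R'}

lemma heq_of_tmul {H H₁ : U ⟶ U'} {M : Bimod R S} {N : Bimod S U} {K : Bimod R' U'}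
    {θ : Cell F H (M.comp N) K} {θ₁ : Cell F₁ H₁ (M.comp N) K} (hF : F = F₁) (hH : H = H₁)
    (w : ∀ (r : Coll R) (s : Coll S) (u : Coll U) (x : (M.F.obj (op r)).obj.obj s)
      (z : (N.F.obj (op s)).obj.obj u), HEq (θ.fn (M.tmul N x z)) (θ₁.fn (M.tmul N x z))) :
    HEq θ θ₁ := by
  subst hF hH
  exact heq_of_eq (Cell.ext (NatTrans.ext (funext fun r => Bimod.comp_ext fun s u x z =>
    eq_of_heq (w r.unop s u x z))))

lemma heq_of_tmul₃ {H H₁ : V ⟶ V'} {M : Bimod R S} {N : Bimod S U} {P : Bimod U V}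
    {K : Bimod R' V'} {θ : Cell F H ((M.comp N).comp P) K} {θ₁ : Cell F₁ H₁ ((M.comp N).comp P) K}
    (hF : F = F₁) (hH : H = H₁)
    (w : ∀ (r : Coll R) (s : Coll S) (u : Coll U) (v : Coll V) (x : (M.F.obj (op r)).obj.obj s)
      (z : (N.F.obj (op s)).obj.obj u) (q : (P.F.obj (op u)).obj.obj v),
      HEq (θ.fn ((M.comp N).tmul P (M.tmul N x z) q))
        (θ₁.fn ((M.comp N).tmul P (M.tmul N x z) q))) : HEq θ θ₁ := by
  subst hF hH
  exact heq_of_eq (Cell.ext (NatTrans.ext (funext fun r => Bimod.comp_ext₃ fun s u v x z q =>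
    eq_of_heq (w r.unop s u v x z q))))

end

end

end Cell

end AlgData

end

noncomputable section

namespace AlgData

variable {T : Type u} [SmallCategory T] {R R' R'' S S' S'' U U' U'' V V' W X Y : Schema T}

namespace Cell

lemma vComp_ofHom {M N P : Bimod R S} (α : M ⟶ N) (β : N ⟶ P) :
    HEq (vComp (ofHom α) (ofHom β)) (ofHom (α ≫ β)) :=
  heq_of_fn rfl rfl fun r s x => (vComp_fn _ _ x).trans
    ((fn_heq _ (Coll.mapId_obj r) (Coll.mapId_obj s) (ofHom_fn α x)).trans
      ((ofHom_fn β _).trans (ofHom_fn (α ≫ β) x).symm))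

lemma vComp_ofHom_id {M N : Bimod R S} (α : M ≅ N) :
    HEq (vComp (ofHom α.hom) (ofHom α.inv)) (ofHom (𝟙 M)) := by
  rw [← α.hom_inv_id]
  exact vComp_ofHom _ _

lemma vComp_ofHom_id' {M N : Bimod R S} (α : M ≅ N) :
    HEq (vComp (ofHom α.inv) (ofHom α.hom)) (ofHom (𝟙 N)) := by
  rw [← α.inv_hom_id]
  exact vComp_ofHom _ _

lemma vId_fn (M : Bimod R S) {r : Coll R} {s : Coll S} (x : (M.F.obj (op r)).obj.obj s) :
    HEq ((ofHom (𝟙 M)).fn x) x := ofHom_fn (𝟙 M) x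

lemma unitEl_heq {r r₁ s s₁ : Coll R} {f : r ⟶ s} {f₁ : r₁ ⟶ s₁} (hr : r = r₁) (hs : s = s₁)
    (h : HEq f f₁) : HEq (Bimod.unitEl f) (Bimod.unitEl f₁) := by
  subst hr hs
  cases h
  rfl

lemma mapId_heq {r s : Coll R} (f : r ⟶ s) : HEq ((Coll.map (𝟙 R)).map f) f := by
  cases r <;> cases s <;> first | exact PEmpty.elim f | exact HEq.rfl

lemma mapComp_heq (F : R ⟶ S) (G : S ⟶ U) {r s : Coll R} (f : r ⟶ s) :
    HEq ((Coll.map (F ≫ G)).map f) ((Coll.map G).map ((Coll.map F).map f)) := by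
  cases r <;> cases s <;> first | exact PEmpty.elim f | exact HEq.rfl

lemma vId_vComp {F : R ⟶ R'} {G : S ⟶ S'} {M : Bimod R S} {M' : Bimod R' S'} (θ : Cell F G M M') :
    HEq (vComp (ofHom (𝟙 M)) θ) θ :=
  heq_of_fn rfl rfl fun r s x => (vComp_fn _ _ x).trans
    (fn_heq θ (Coll.mapId_obj r) (Coll.mapId_obj s) (vId_fn M x))

lemma vComp_vId {F : R ⟶ R'} {G : S ⟶ S'} {M : Bimod R S} {M' : Bimod R' S'} (θ : Cell F G M M') :
    HEq (vComp θ (ofHom (𝟙 M'))) θ :=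
  heq_of_fn rfl rfl fun _ _ x => (vComp_fn _ _ x).trans (vId_fn M' (θ.fn x))

lemma vComp_assoc {F : R ⟶ R'} {G : S ⟶ S'} {F' : R' ⟶ R''} {G' : S' ⟶ S''} {F'' : R'' ⟶ U}
    {G'' : S'' ⟶ V} {M : Bimod R S} {M' : Bimod R' S'} {M'' : Bimod R'' S''} {M₃ : Bimod U V}
    (θ : Cell F G M M') (θ' : Cell F' G' M' M'') (θ'' : Cell F'' G'' M'' M₃) :
    HEq (vComp (vComp θ θ') θ'') (vComp θ (vComp θ' θ'')) :=
  heq_of_fn rfl rfl fun r s x => (vComp_fn _ _ x).trans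
    ((fn_heq θ'' (Coll.mapComp_obj F F' r) (Coll.mapComp_obj G G' s) (vComp_fn θ θ' x)).trans
      ((vComp_fn θ' θ'' (θ.fn x)).symm.trans (vComp_fn θ (vComp θ' θ'') x).symm))

lemma unit_id (R : Schema T) : unit (𝟙 R) = ofHom (𝟙 (Bimod.unit R)) :=
  eq_of_heq (heq_of_fn rfl rfl fun r s x => HEq.trans
    (unitEl_heq (Coll.mapId_obj r) (Coll.mapId_obj s) (mapId_heq (toHom x)))
    (vId_fn (Bimod.unit R) x).symm)

lemma unit_comp (F : R ⟶ R') (F' : R' ⟶ R'') : unit (F ≫ F') = vComp (unit F) (unit F') :=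
  eq_of_heq (heq_of_fn rfl rfl fun r s x => HEq.trans
    (unitEl_heq (Coll.mapComp_obj F F' r) (Coll.mapComp_obj F F' s) (mapComp_heq F F' (toHom x)))
    (vComp_fn (unit F) (unit F') x).symm)

section

variable [HasFiniteProducts T]

lemma heq_of_tmul₄ {F F₁ : R ⟶ R'} {H H₁ : W ⟶ V'} {M : Bimod R S} {N : Bimod S U} {P : Bimod U V}
    {Q : Bimod V W} {K : Bimod R' V'} {θ : Cell F H (((M.comp N).comp P).comp Q) K}
    {θ₁ : Cell F₁ H₁ (((M.comp N).comp P).comp Q) K} (hF : F = F₁) (hH : H = H₁)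
    (w : ∀ (r : Coll R) (s : Coll S) (u : Coll U) (v : Coll V) (t : Coll W)
      (x : (M.F.obj (op r)).obj.obj s) (z : (N.F.obj (op s)).obj.obj u)
      (p : (P.F.obj (op u)).obj.obj v) (q : (Q.F.obj (op v)).obj.obj t),
      HEq (θ.fn (((M.comp N).comp P).tmul Q ((M.comp N).tmul P (M.tmul N x z) p) q))
        (θ₁.fn (((M.comp N).comp P).tmul Q ((M.comp N).tmul P (M.tmul N x z) p) q))) :
    HEq θ θ₁ := by
  subst hF hH
  refine heq_of_eq (Cell.ext (NatTrans.ext (funext fun r => ?_)))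
  apply (Q.adj.homEquiv _ _).injective
  refine Bimod.comp_ext₃ fun s u v x z p => ?_
  refine congrArg (Bimod.Γel (M := Q)) (inst_ext fun t q => ?_)
  exact eq_of_heq (w r.unop s u v t x z p q)

lemma hComp_heq {F : R ⟶ R'} {G : S ⟶ S'} {H : U ⟶ U'} {M : Bimod R S}
    {M' : Bimod R' S'} {N : Bimod S U} {N' : Bimod S' U'} (θ : Cell F G M M') (φ : Cell G H N N')
    {r : Coll R} {s : Coll S} {u : Coll U} (x : (M.F.obj (op r)).obj.obj s)
    (z : (N.F.obj (op s)).obj.obj u) :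
    HEq ((hComp θ φ).fn (M.tmul N x z)) (M'.tmul N' (θ.fn x) (φ.fn z)) :=
  heq_of_eq (hComp_fn θ φ x z)

lemma hComp_vId (M : Bimod R S) (N : Bimod S U) :
    hComp (ofHom (𝟙 M)) (ofHom (𝟙 N)) = ofHom (𝟙 (M.comp N)) :=
  eq_of_heq (heq_of_tmul rfl rfl fun r s u x z => (hComp_heq _ _ x z).trans
    ((tmul_heq M N (Coll.mapId_obj r) (Coll.mapId_obj s) (Coll.mapId_obj u) (vId_fn M x)
      (vId_fn N z)).trans (vId_fn (M.comp N) _).symm))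

lemma hComp_vComp {F : R ⟶ R'} {G : S ⟶ S'} {H : U ⟶ U'} {F' : R' ⟶ R''} {G' : S' ⟶ S''}
    {H' : U' ⟶ U''} {M : Bimod R S} {N : Bimod S U} {M' : Bimod R' S'} {N' : Bimod S' U'}
    {M'' : Bimod R'' S''} {N'' : Bimod S'' U''} (θ : Cell F G M M') (φ : Cell G H N N')
    (θ' : Cell F' G' M' M'') (φ' : Cell G' H' N' N'') :
    hComp (vComp θ θ') (vComp φ φ') = vComp (hComp θ φ) (hComp θ' φ') :=
  eq_of_heq (heq_of_tmul rfl rfl fun r s u x z => (hComp_heq _ _ x z).trans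
    ((tmul_heq M'' N'' (Coll.mapComp_obj F F' r) (Coll.mapComp_obj G G' s)
      (Coll.mapComp_obj H H' u) (vComp_fn θ θ' x) (vComp_fn φ φ' z)).trans
      ((hComp_heq θ' φ' (θ.fn x) (φ.fn z)).symm.trans
        ((heq_of_eq (congrArg (fn (hComp θ' φ')) (hComp_fn θ φ x z)).symm).trans
          (vComp_fn (hComp θ φ) (hComp θ' φ') _).symm))))

lemma assoc_fn (M : Bimod R S) (N : Bimod S U) (P : Bimod U V) {r : Coll R} {s : Coll S}
    {u : Coll U} {v : Coll V} (x : (M.F.obj (op r)).obj.obj s) (z : (N.F.obj (op s)).obj.obj u)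
    (q : (P.F.obj (op u)).obj.obj v) :
    HEq ((ofHom (Bimod.assoc M N P).hom).fn ((M.comp N).tmul P (M.tmul N x z) q))
      (M.tmul (N.comp P) x (N.tmul P z q)) :=
  (ofHom_fn _ _).trans (heq_of_eq (Bimod.assoc_hom_tmul M N P x z q))

lemma hComp_heq₃ {F : R ⟶ R'} {G : S ⟶ S'} {H : U ⟶ U'} {K : V ⟶ V'} {M : Bimod R S}
    {M' : Bimod R' S'} {N : Bimod S U} {N' : Bimod S' U'} {P : Bimod U V} {P' : Bimod U' V'}
    (θ : Cell F G M M') (φ : Cell G H N N') (ψ : Cell H K P P') {r : Coll R} {s : Coll S}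
    {u : Coll U} {v : Coll V} (x : (M.F.obj (op r)).obj.obj s) (z : (N.F.obj (op s)).obj.obj u)
    (q : (P.F.obj (op u)).obj.obj v) :
    (hComp (hComp θ φ) ψ).fn ((M.comp N).tmul P (M.tmul N x z) q) =
      (M'.comp N').tmul P' (M'.tmul N' (θ.fn x) (φ.fn z)) (ψ.fn q) :=
  (hComp_fn _ _ _ _).trans (congrArg (fun k => (M'.comp N').tmul P' k (ψ.fn q)) (hComp_fn θ φ x z))

lemma hComp_heq₃' {F : R ⟶ R'} {G : S ⟶ S'} {H : U ⟶ U'} {K : V ⟶ V'} {M : Bimod R S}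
    {M' : Bimod R' S'} {N : Bimod S U} {N' : Bimod S' U'} {P : Bimod U V} {P' : Bimod U' V'}
    (θ : Cell F G M M') (φ : Cell G H N N') (ψ : Cell H K P P') {r : Coll R} {s : Coll S}
    {u : Coll U} {v : Coll V} (x : (M.F.obj (op r)).obj.obj s) (z : (N.F.obj (op s)).obj.obj u)
    (q : (P.F.obj (op u)).obj.obj v) :
    (hComp θ (hComp φ ψ)).fn (M.tmul (N.comp P) x (N.tmul P z q)) =
      M'.tmul (N'.comp P') (θ.fn x) (N'.tmul P' (φ.fn z) (ψ.fn q)) :=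
  (hComp_fn _ _ _ _).trans (congrArg (fun k => M'.tmul (N'.comp P') (θ.fn x) k) (hComp_fn φ ψ z q))

lemma assoc_nat {F : R ⟶ R'} {G : S ⟶ S'} {H : U ⟶ U'} {K : V ⟶ V'} {M : Bimod R S}
    {M' : Bimod R' S'} {N : Bimod S U} {N' : Bimod S' U'} {P : Bimod U V} {P' : Bimod U' V'}
    (θ : Cell F G M M') (φ : Cell G H N N') (ψ : Cell H K P P') :
    HEq (vComp (hComp (hComp θ φ) ψ) (ofHom (Bimod.assoc M' N' P').hom))
      (vComp (ofHom (Bimod.assoc M N P).hom) (hComp θ (hComp φ ψ))) :=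
  heq_of_tmul₃ rfl rfl fun r _ _ v x z q => (vComp_fn _ _ _).trans
    ((heq_of_eq (congrArg (fn _) (hComp_heq₃ θ φ ψ x z q))).trans
      ((assoc_fn M' N' P' (θ.fn x) (φ.fn z) (ψ.fn q)).trans
        ((heq_of_eq (hComp_heq₃' θ φ ψ x z q).symm).trans
          ((fn_heq (hComp θ (hComp φ ψ)) (Coll.mapId_obj r) (Coll.mapId_obj v)
            (assoc_fn M N P x z q)).symm.trans
            (vComp_fn _ _ _).symm))))

lemma leftUnitor_nat {F : R ⟶ R'} {G : S ⟶ S'} {M : Bimod R S} {M' : Bimod R' S'}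
    (θ : Cell F G M M') :
    HEq (vComp (hComp (unit F) θ) (ofHom (Bimod.leftUnitor M').hom))
      (vComp (ofHom (Bimod.leftUnitor M).hom) θ) :=
  heq_of_tmul rfl rfl fun r _ s f x => (vComp_fn _ _ _).trans
    ((heq_of_eq (congrArg (fn _) (hComp_fn (unit F) θ f x))).trans
      ((ofHom_fn _ _).trans
        ((heq_of_eq (Bimod.leftUnitor_hom_tmul M' ((Coll.map F).map (toHom f)) (θ.fn x))).trans
          ((heq_of_eq (fn_bmap θ x (toHom f)).symm).trans
            ((fn_heq θ (Coll.mapId_obj r) (Coll.mapId_obj s) ((ofHom_fn _ _).trans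
              (heq_of_eq (Bimod.leftUnitor_hom_tmul M (toHom f) x)))).symm.trans
              (vComp_fn _ _ _).symm)))))

lemma rightUnitor_nat {F : R ⟶ R'} {G : S ⟶ S'} {M : Bimod R S} {M' : Bimod R' S'}
    (θ : Cell F G M M') :
    HEq (vComp (hComp θ (unit G)) (ofHom (Bimod.rightUnitor M').hom))
      (vComp (ofHom (Bimod.rightUnitor M).hom) θ) :=
  heq_of_tmul rfl rfl fun r _ s' x f => (vComp_fn _ _ _).trans
    ((heq_of_eq (congrArg (fn _) (hComp_fn θ (unit G) x f))).trans
      ((ofHom_fn _ _).trans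
        ((heq_of_eq (Bimod.rightUnitor_hom_tmul M' (θ.fn x) ((Coll.map G).map (toHom f)))).trans
          ((heq_of_eq (fn_act θ x (toHom f)).symm).trans
            ((fn_heq θ (Coll.mapId_obj r) (Coll.mapId_obj s') ((ofHom_fn _ _).trans
              (heq_of_eq (Bimod.rightUnitor_hom_tmul M x (toHom f))))).symm.trans
              (vComp_fn _ _ _).symm)))))

lemma pentagon (M : Bimod R S) (N : Bimod S U) (P : Bimod U V) (Q : Bimod V W) :
    HEq (vComp (vComp (hComp (ofHom (Bimod.assoc M N P).hom) (ofHom (𝟙 Q)))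
        (ofHom (Bimod.assoc M (N.comp P) Q).hom))
        (hComp (ofHom (𝟙 M)) (ofHom (Bimod.assoc N P Q).hom)))
      (vComp (ofHom (Bimod.assoc (M.comp N) P Q).hom) (ofHom (Bimod.assoc M N (P.comp Q)).hom)) :=
  heq_of_tmul₄ rfl rfl fun r s u v t x z p q => by
    refine (vComp_fn _ _ _).trans (HEq.trans ?_ (vComp_fn _ _ _).symm)
    have h1 : HEq ((hComp (ofHom (Bimod.assoc M N P).hom) (ofHom (𝟙 Q))).fn
        (((M.comp N).comp P).tmul Q ((M.comp N).tmul P (M.tmul N x z) p) q))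
        ((M.comp (N.comp P)).tmul Q (M.tmul (N.comp P) x (N.tmul P z p)) q) :=
      (hComp_heq _ _ _ _).trans (tmul_heq _ _ (Coll.mapId_obj r) (Coll.mapId_obj v)
        (Coll.mapId_obj t) (assoc_fn M N P x z p) (vId_fn Q q))
    have h2 := (vComp_fn (hComp (ofHom (Bimod.assoc M N P).hom) (ofHom (𝟙 Q)))
        (ofHom (Bimod.assoc M (N.comp P) Q).hom) _).trans
      ((fn_heq (ofHom (Bimod.assoc M (N.comp P) Q).hom) (Coll.mapId_obj r) (Coll.mapId_obj t)
        h1).trans (assoc_fn M (N.comp P) Q x (N.tmul P z p) q))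
    refine (fn_heq _ (Coll.mapId_obj r) (Coll.mapId_obj t) h2).trans ?_
    refine (hComp_heq _ _ _ _).trans ?_
    refine (tmul_heq _ _ (Coll.mapId_obj r) (Coll.mapId_obj s)
        (Coll.mapId_obj t) (vId_fn M x) (assoc_fn N P Q z p q)).trans ?_
    exact (assoc_fn M N (P.comp Q) x z (P.tmul Q p q)).symm.trans
      (fn_heq _ (Coll.mapId_obj r) (Coll.mapId_obj t) (assoc_fn (M.comp N) P Q _ p q)).symm

lemma triangle (M : Bimod R S) (N : Bimod S U) :
    HEq (vComp (ofHom (Bimod.assoc M (Bimod.unit S) N).hom)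
        (hComp (ofHom (𝟙 M)) (ofHom (Bimod.leftUnitor N).hom)))
      (hComp (ofHom (Bimod.rightUnitor M).hom) (ofHom (𝟙 N))) :=
  heq_of_tmul₃ rfl rfl fun r s s' u x f z => by
    refine (vComp_fn _ _ _).trans ?_
    refine (fn_heq _ (Coll.mapId_obj r) (Coll.mapId_obj u) (assoc_fn M _ N x f z)).trans ?_
    refine (hComp_heq _ _ _ _).trans ?_
    refine (tmul_heq _ _ (Coll.mapId_obj r) (Coll.mapId_obj s) (Coll.mapId_obj u) (vId_fn M x)
      ((ofHom_fn _ _).trans (heq_of_eq (Bimod.leftUnitor_hom_tmul N (toHom f) z)))).trans ?_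
    refine (heq_of_eq (Bimod.tmul_bmap M N x z (toHom f))).trans ?_
    refine HEq.trans ?_ (hComp_heq _ _ _ _).symm
    exact (tmul_heq _ _ (Coll.mapId_obj r) (Coll.mapId_obj s') (Coll.mapId_obj u)
      ((ofHom_fn _ _).trans (heq_of_eq (Bimod.rightUnitor_hom_tmul M x (toHom f))))
      (vId_fn N z)).symm

end

lemma cart_fn (F : R ⟶ R') (G : S ⟶ S') (N : Bimod R' S') {r : Coll R} {s : Coll S}
    (x : ((Bimod.restr F G N).F.obj (op r)).obj.obj s) : (cart F G N).fn x = x := rfl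

/-- The factorisation of a 2-cell through a cartesian 2-cell. -/
def lift (F : R ⟶ R') (G : S ⟶ S') (N : Bimod R' S') (H : X ⟶ R) (K : Y ⟶ S) (M : Bimod X Y)
    (θ : Cell (H ≫ F) (K ≫ G) M N) : Cell H K M (Bimod.restr F G N) where
  nat :=
    { app := fun r => ObjectProperty.homMk
        { app := fun s => ↾fun x => N.bmap ((Coll.mapComp H F).inv.app r.unop)
            (act ((Coll.mapComp K G).hom.app s) (θ.fn x))
          naturality := fun s s' g => by
            refine ConcreteCategory.hom_ext _ _ fun x => ?_
            change N.bmap _ (act ((Coll.mapComp K G).hom.app s') (θ.fn (act g x))) =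
              act ((Coll.map G).map ((Coll.map K).map g)) (N.bmap _
                (act ((Coll.mapComp K G).hom.app s) (θ.fn x)))
            rw [fn_act, ← act_comp, ← Bimod.bmap_act, ← act_comp]
            exact congrArg (fun k => N.bmap _ (act k (θ.fn x))) ((Coll.mapComp K G).hom.naturality g) }
      naturality := fun r r' f => inst_ext fun s x => by
        change N.bmap ((Coll.mapComp H F).inv.app r'.unop)
            (act ((Coll.mapComp K G).hom.app s) (θ.fn (M.bmap f.unop x))) =
          N.bmap ((Coll.map F).map ((Coll.map H).map f.unop))
            (N.bmap ((Coll.mapComp H F).inv.app r.unop)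
              (act ((Coll.mapComp K G).hom.app s) (θ.fn x)))
        rw [fn_bmap, ← Bimod.bmap_act, ← Bimod.bmap_comp, ← Bimod.bmap_comp]
        exact congrArg (fun k => N.bmap k (act _ (θ.fn x)))
          ((Coll.mapComp H F).inv.naturality f.unop).symm }
  nat_ty t := inst_ext fun s x => (nat_ty_iff _ t x).2 (by
    cases s with
    | ent e => exact PEmpty.elim (M.tyHom x)
    | ty t' =>
      change N.tyHom (t := t) (s := .ty t') (N.bmap (𝟙 _) (act (𝟙 _) (θ.fn x))) = M.tyHom x
      rw [Bimod.bmap_id]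
      exact (congrArg (N.tyHom (t := t) (s := .ty t')) (act_id _)).trans (tyHom_fn θ x))

lemma lift_fn (F : R ⟶ R') (G : S ⟶ S') (N : Bimod R' S') (H : X ⟶ R) (K : Y ⟶ S) (M : Bimod X Y)
    (θ : Cell (H ≫ F) (K ≫ G) M N) {r : Coll X} {s : Coll Y} (x : (M.F.obj (op r)).obj.obj s) :
    HEq ((lift F G N H K M θ).fn x) (θ.fn x) := by
  have key : (lift F G N H K M θ).fn x = N.bmap ((Coll.mapComp H F).inv.app r)
            (act ((Coll.mapComp K G).hom.app s) (θ.fn x)) := rfl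
  rw [key]
  cases r <;> cases s <;> exact heq_of_eq ((N.bmap_id _).trans (act_id _))

lemma cart_universal (F : R ⟶ R') (G : S ⟶ S') (N : Bimod R' S') (H : X ⟶ R) (K : Y ⟶ S)
    (M : Bimod X Y) (θ : Cell (H ≫ F) (K ≫ G) M N) :
    ∃! θ' : Cell H K M (Bimod.restr F G N), vComp θ' (cart F G N) = θ := by
  refine ⟨lift F G N H K M θ, eq_of_heq (heq_of_fn rfl rfl fun r s x =>
    (vComp_fn _ _ x).trans (lift_fn F G N H K M θ x)), fun θ' h => ext_fn fun r s x => ?_⟩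
  refine eq_of_heq (HEq.trans ?_ (lift_fn F G N H K M θ x).symm)
  rw [← h]
  exact (vComp_fn θ' (cart F G N) x).symm

end Cell

/-- The equipment of schemas over `T`, schema mappings, bimodules, and 2-cells of bimodules. -/
def Data (T : Type u) [SmallCategory T] [HasFiniteProducts T] : Equipment.{u, u, u + 1, u + 1} where
  Obj := Schema T
  Hor := Bimod
  Cell := Cell
  vId M := .ofHom (𝟙 M)
  vComp := .vComp
  vId_vComp := Cell.vId_vComp
  vComp_vId := Cell.vComp_vId
  vComp_assoc := Cell.vComp_assoc
  hId := .unit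
  hIdCell := .unit
  hIdCell_id := Cell.unit_id
  hIdCell_comp := Cell.unit_comp
  hComp := .comp
  hCompCell := .hComp
  hCompCell_vId := Cell.hComp_vId
  hCompCell_vComp := Cell.hComp_vComp
  assocHom M N P := .ofHom (Bimod.assoc M N P).hom
  assocInv M N P := .ofHom (Bimod.assoc M N P).inv
  assocHom_assocInv _ _ _ := Cell.vComp_ofHom_id _
  assocInv_assocHom _ _ _ := Cell.vComp_ofHom_id' _
  assocHom_naturality := Cell.assoc_nat
  leftUnitorHom M := .ofHom M.leftUnitor.hom
  leftUnitorInv M := .ofHom M.leftUnitor.inv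
  leftUnitorHom_leftUnitorInv _ := Cell.vComp_ofHom_id _
  leftUnitorInv_leftUnitorHom _ := Cell.vComp_ofHom_id' _
  leftUnitorHom_naturality := Cell.leftUnitor_nat
  rightUnitorHom M := .ofHom M.rightUnitor.hom
  rightUnitorInv M := .ofHom M.rightUnitor.inv
  rightUnitorHom_rightUnitorInv _ := Cell.vComp_ofHom_id _
  rightUnitorInv_rightUnitorHom _ := Cell.vComp_ofHom_id' _
  rightUnitorHom_naturality := Cell.rightUnitor_nat
  pentagon := Cell.pentagon
  triangle := Cell.triangle
  restr := .restr
  cart := Cell.cart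
  cart_universal := Cell.cart_universal

end AlgData

end

noncomputable section

namespace AlgData

variable {T : Type u} [SmallCategory T] {R S U : Schema T}

/-- The inclusion of the entities into the collage. -/
def Coll.inE (S : Schema T) : S.Ent ⥤ Coll S where
  obj e := .ent e
  map f := f
  map_id _ := rfl
  map_comp _ _ := rfl

namespace Bimod

/-- The morphism from the instance represented by `t` to `Γ_N (P t)` which corresponds to the
isomorphism `N(t) ≅ y(t) ≅ P(t)`, as an element of `Γ_N (P t)` of type `t`. -/
def rightHomTy (N : Bimod S U) (P : Bimod R U) (t : T) :
    (y S).obj (op (.ty t)) ⟶ N.Γ.obj (P.F.obj (op (.ty t))) :=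
  el (s := .ty t) (Γel (M := N) (r := .ty t) ((N.tyIso t).hom ≫ (P.tyIso t).inv))

lemma rightHomTy_nat (N : Bimod S U) (P : Bimod R U) {t t' : T} (f : t ⟶ t') :
    (y S).map (Coll.tyHom S f).op ≫ rightHomTy N P t =
      rightHomTy N P t' ≫ N.Γ.map (P.F.map (Coll.tyHom R f).op) := by
  refine (y_map_el (s := .ty t) (s' := .ty t') (Coll.tyHom S f) _).trans
    (Eq.trans (congrArg (el (s := .ty t')) ?_) (el_comp (s := .ty t') _ _).symm)
  change Γel (M := N) (r := .ty t') (N.F.map (Coll.tyHom S f).op ≫ (N.tyIso t).hom ≫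
    (P.tyIso t).inv) = Γel (M := N) (r := .ty t') (((N.tyIso t').hom ≫ (P.tyIso t').inv) ≫
      P.F.map (Coll.tyHom R f).op)
  rw [← Category.assoc, N.tyIso_nat, Category.assoc, P.tyIso_inv_nat, Category.assoc]

/-- The values of the right hom: `Γ_N (P e)` at an entity `e`, and the instance represented by `t`
at a type `t`. -/
def rightHomObj (N : Bimod S U) (P : Bimod R U) : Coll R → Inst S
  | .ent e => N.Γ.obj (P.F.obj (op (.ent e)))
  | .ty t => (y S).obj (op (.ty t))

/-- The action of the right hom: `Γ_N (P f)` on a morphism `f` of entities, and the composite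
`y(t) ⟶ Γ_N (P t) ⟶ Γ_N (P e)` on an observable of `e` of type `t`. -/
def rightHomMor (N : Bimod S U) (P : Bimod R U) :
    {a b : Coll R} → (a ⟶ b) → (rightHomObj N P b ⟶ rightHomObj N P a)
  | .ent _, .ent _, f => N.Γ.map (P.F.map f.op)
  | .ent _, .ty t, f => rightHomTy N P t ≫ N.Γ.map (P.F.map f.op)
  | .ty _, .ty _, f => (y S).map (Coll.tyHom S f).op

/-- The right hom `N ▷ P`: the functor `Γ_N ∘ P` on entities and observables, with every type sent
to the instance represented by it. -/
def rightHom (N : Bimod S U) (P : Bimod R U) : Bimod R S where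
  F :=
    { obj := fun a => rightHomObj N P a.unop
      map := fun f => rightHomMor N P f.unop
      map_id := fun ⟨a⟩ => by
        cases a with
        | ent e => exact (congrArg N.Γ.map (P.F.map_id _)).trans (N.Γ.map_id _)
        | ty t => exact (y S).map_id _
      map_comp := fun {a b c} f g => by
        obtain ⟨a⟩ := a
        obtain ⟨b⟩ := b
        obtain ⟨c⟩ := c
        obtain ⟨f, rfl⟩ : ∃ f', f = Quiver.Hom.op f' := ⟨f.unop, rfl⟩
        obtain ⟨g, rfl⟩ : ∃ g', g = Quiver.Hom.op g' := ⟨g.unop, rfl⟩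
        have h := (congrArg N.Γ.map (P.F.map_comp f.op g.op)).trans (N.Γ.map_comp _ _)
        cases c <;> cases b <;> first | exact PEmpty.elim g | skip
        all_goals cases a <;> first | exact PEmpty.elim f | skip
        · exact h
        · rename_i e e' t
          exact (congrArg (rightHomTy N P t ≫ ·) h).trans (Category.assoc _ _ _).symm
        · rename_i e t t'
          refine (congrArg (rightHomTy N P t' ≫ ·) h).trans ?_
          refine (Category.assoc _ _ _).symm.trans (Eq.trans ?_ (Category.assoc _ _ _))
          exact congrArg (· ≫ N.Γ.map (P.F.map g.op)) (rightHomTy_nat N P f).symm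
        · exact (y S).map_comp (Coll.tyHom S f).op (Coll.tyHom S g).op }
  tyIso t := Iso.refl ((y S).obj (op (.ty t)))
  tyIso_nat f := (Category.comp_id _).trans (Category.id_comp _).symm

/-- The comparison from the right hom to the composite functor `Γ_N ∘ P`. -/
def rightHomι (N : Bimod S U) (P : Bimod R U) : (rightHom N P).F ⟶ P.F ⋙ N.Γ where
  app a := match a with
    | ⟨.ent e⟩ => 𝟙 (N.Γ.obj (P.F.obj (op (.ent e))))
    | ⟨.ty t⟩ => rightHomTy N P t
  naturality := fun ⟨a⟩ ⟨b⟩ f => by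
    obtain ⟨f, rfl⟩ : ∃ f', f = Quiver.Hom.op f' := ⟨f.unop, rfl⟩
    cases b <;> cases a <;> first | exact PEmpty.elim f | skip
    · exact (Category.comp_id _).trans (Category.id_comp _).symm
    · exact Category.comp_id _
    · exact rightHomTy_nat N P f

/-- Functoriality of the right hom: it is given by composition on entities, and is the identity on
types. -/
def rightHomMap {N N' : Bimod S U} {P P' : Bimod R U} (ψ : N' ⟶ N) (ρ : P ⟶ P') :
    rightHom N P ⟶ rightHom N' P' where
  nat :=
    { app := fun a => match a with
        | ⟨.ent e⟩ => ObjectProperty.homMk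
            { app := fun s => ↾fun g => Γel (M := N') (ψ.nat.app (op s) ≫ Γhom (M := N) g ≫
                ρ.nat.app (op (.ent e)))
              naturality := fun s s' f => by
                refine ConcreteCategory.hom_ext _ _ fun g => ?_
                change Γel (M := N') (ψ.nat.app (op s') ≫ (N.F.map f.op ≫ Γhom (M := N) g) ≫ _) =
                  Γel (M := N') (N'.F.map f.op ≫ ψ.nat.app (op s) ≫ Γhom (M := N) g ≫ _)
                rw [← Category.assoc, ← Category.assoc (ψ.nat.app _), ← ψ.nat.naturality]
                simp only [Category.assoc] }
        | ⟨.ty t⟩ => 𝟙 ((y S).obj (op (.ty t)))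
      naturality := fun ⟨a⟩ ⟨b⟩ f => by
        obtain ⟨f, rfl⟩ : ∃ f', f = Quiver.Hom.op f' := ⟨f.unop, rfl⟩
        cases b <;> cases a <;> first | exact PEmpty.elim f | skip
        · rename_i e e'
          refine inst_ext fun s g => ?_
          change Γel (M := N') (ψ.nat.app (op s) ≫ (Γhom (M := N) g ≫ P.F.map f.op) ≫ _) =
            Γel (M := N') ((ψ.nat.app (op s) ≫ Γhom (M := N) g ≫ _) ≫ P'.F.map f.op)
          refine congrArg (Γel (M := N')) ?_
          have h := ρ.nat.naturality f.op
          simp only [Category.assoc]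
          rw [← h]
        · rename_i e t
          refine Eq.trans ?_ (Category.id_comp (rightHomTy N' P' t ≫ N'.Γ.map (P'.F.map f.op))).symm
          have h : (P.tyIso t).inv ≫ ρ.nat.app (op (.ty t)) = (P'.tyIso t).inv := by
            rw [Iso.inv_comp_eq, ← ρ.nat_ty, Category.assoc, Iso.hom_inv_id, Category.comp_id]
          refine (congrArg (· ≫ _) (el_comp (s := .ty t) _ _)).trans
            ((el_comp (s := .ty t) _ _).trans (Eq.trans (congrArg (el (s := .ty t)) ?_)
              (el_comp (s := .ty t) _ _).symm))
          change Γel (M := N') (r := .ty t) (ψ.nat.app (op (.ty t)) ≫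
            (((N.tyIso t).hom ≫ (P.tyIso t).inv) ≫ P.F.map f.op) ≫ ρ.nat.app (op (.ent e))) =
            Γel (M := N') (r := .ty t) (((N'.tyIso t).hom ≫ (P'.tyIso t).inv) ≫ P'.F.map f.op)
          refine congrArg (Γel (M := N') (r := .ty t)) ?_
          rw [← ψ.nat_ty, ← h]
          simp only [Category.assoc]
          rw [← ρ.nat.naturality]
        · exact (Category.comp_id _).trans (Category.id_comp _).symm }
  nat_ty t := Category.comp_id _

end Bimod

end AlgData

end

open AlgData

/-! If types are ignored, the statement is the adjunction `Λ N.F ⊣ N.Γ` applied objectwise: natural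
transformations from Λ_N ∘ M to P correspond to natural transformations from M to Γ_N ∘ P. But Γ_N ∘
P need not be a bimodule, because Γ_N(P(τ)) can have elements at entities (maps N(s) → P(τ)),
whereas y(τ) has none. The right hom therefore puts y(τ) at each type and is attached to Γ_N ∘ P by
ι, which is an identity at entities.

The replacement loses nothing, because a morphism of bimodules has no freedom at types. The
component of κ : M ⊙ N → P at τ has to be the identification (M ⊙ N)(τ) ≅ P(τ), and the component of
M → N ▷ P at τ has to be M(τ) ≅ y(τ). The essential computation, `transpose_tyIso`, says that these
two forced components match: the transpose of the first is the second followed by ι_τ. Hence the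
transpose of every κ factors through ι (`toRightHom_ι`), every morphism into N ▷ P untransposes to a
morphism that respects types (`ofRightHom`), and at entities the bijection is that of the
adjunction. That ι is bijective on elements at types is a separate fact: full faithfulness of the
Yoneda embedding on types (`rightHomTy_bijective`).

The universal property concerns 2-cells whose left side is an arbitrary schema mapping F. A 2-cell
with left side F and identity right side is the same thing as a morphism into the restriction of its
target along F (`restrLeftEquiv`), and the right hom is compatible with this restriction because its
values are computed one object at a time (`rightHomRestrLeft`). Since a 2-cell out of M ⊙ N is
determined by its values on the generators x ⊗ z, the factorisation equation through ε can be tested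
there, where it becomes an explicit formula for the unknown 2-cell
(`hComp_vComp_ofRightHom_eq_iff`). Existence and uniqueness are then immediate. -/

noncomputable section

namespace AlgData

variable {T : Type u} [SmallCategory T] {Q R S U : Schema T}

/-! ### Components at types, restriction on the left, and the comparison ι. -/

namespace Bimod

/-- Morphisms of bimodules are determined by their components at entities. -/
lemma hom_ext_ent {M M' : Bimod R S} {θ φ : M ⟶ M'}
    (w : ∀ e : R.Ent, θ.nat.app (op (.ent e)) = φ.nat.app (op (.ent e))) : θ = φ :=
  hom_ext fun r => match r with
    | .ent e => w e
    -- At a type both components become the identification `M.tyIso t` after composing with the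
    -- isomorphism `M'.tyIso t`, so they agree.
    | .ty t => by rw [← cancel_mono (M'.tyIso t).hom, θ.nat_ty, φ.nat_ty]

/-- Restriction of a bimodule along a schema mapping on the left. -/
def restrLeft (F : Q ⟶ R) (P : Bimod R S) : Bimod Q S where
  F := (Coll.map F).op ⋙ P.F
  tyIso t := P.tyIso t
  tyIso_nat f := P.tyIso_nat f

/-- The right hom is compatible with restriction on the left. -/
def rightHomRestrLeft (F : Q ⟶ R) (N : Bimod S U) (P : Bimod R U) :
    N.rightHom (restrLeft F P) ⟶ restrLeft F (N.rightHom P) where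
  nat :=
    { app := fun a => match a with
        | ⟨.ent e⟩ => 𝟙 (N.Γ.obj (P.F.obj (op (.ent (F.ent.obj e)))))
        | ⟨.ty t⟩ => 𝟙 ((y S).obj (op (.ty t)))
      naturality := fun ⟨a⟩ ⟨b⟩ f => by
        obtain ⟨f, rfl⟩ : ∃ f', f = Quiver.Hom.op f' := ⟨f.unop, rfl⟩
        cases b <;> cases a <;> first | exact PEmpty.elim f | skip
        -- Once the objects are known to be entities or types, both bimodules act by the same
        -- morphism definitionally; for an observable this holds because `restrLeft` keeps the
        -- identifications at types, so ι_τ is unchanged.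
        all_goals exact (Category.comp_id _).trans (Category.id_comp _).symm }
  nat_ty _ := Category.comp_id _

/-- ι_τ depends on the second bimodule only through its identification at τ, which restriction
leaves alone. This lets the universal property for a general left side be read off from the
bijection for the restricted bimodule. -/
lemma rightHomRestrLeft_ι (F : Q ⟶ R) (N : Bimod S U) (P : Bimod R U) (r : Coll Q) :
    (rightHomRestrLeft F N P).nat.app (op r) ≫ (N.rightHomι P).app (op ((Coll.map F).obj r)) =
      (N.rightHomι (restrLeft F P)).app (op r) := by
  cases r <;> exact Category.id_comp _

/-- Elements of y(t) at t' are morphisms t ⟶ t' of `T`, whichever schema represents t. Under the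
identifications N(t') ≅ y(t') and P(t) ≅ y(t), the map ι_t becomes the action of the Yoneda
embedding of `U` on these morphisms, and that embedding is fully faithful. -/
lemma rightHomTy_bijective (N : Bimod S U) (P : Bimod R U) (t t' : T) :
    Function.Bijective fun x : ((y S).obj (op (.ty t))).obj.obj (.ty t') =>
      ap (rightHomTy N P t) x := by
  -- Naturality of `N.tyIso` moves f from N, where it acts through the collage of `S`, to the
  -- representables of `U`.
  have key (f : t ⟶ t') : ap (rightHomTy N P t) (ofHom (Coll.tyHom S f)) =
      Γel (M := N) (r := .ty t')
        ((N.tyIso t').hom ≫ (y U).map (Coll.tyHom U f).op ≫ (P.tyIso t).inv) := by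
    refine congrArg (Γel (M := N) (r := .ty t')) (?_ : N.F.map (Coll.tyHom S f).op ≫
      (N.tyIso t).hom ≫ (P.tyIso t).inv = _)
    rw [← Category.assoc, ← Category.assoc, N.tyIso_nat]
  constructor
  · intro (f : t ⟶ t') (f' : t ⟶ t') h
    have h' : (N.tyIso t').hom ≫ (y U).map (Coll.tyHom U f).op ≫ (P.tyIso t).inv =
        (N.tyIso t').hom ≫ (y U).map (Coll.tyHom U f').op ≫ (P.tyIso t).inv :=
      (key f).symm.trans (Eq.trans h (key f'))
    -- Only the two representable morphisms remain; evaluating them at the identity of t recovers f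
    -- and f'.
    rw [cancel_epi, cancel_mono] at h'
    have h₂ := congrArg (fun g => toHom (ev g)) h'
    exact ((Category.comp_id f).symm.trans h₂).trans (Category.comp_id f')
  · intro g
    let k : (y U).obj (op (.ty t')) ⟶ (y U).obj (op (.ty t)) :=
      (N.tyIso t').inv ≫ Γhom (M := N) (r := .ty t') g ≫ (P.tyIso t).hom
    let f : t ⟶ t' := toHom (ev k)
    -- By the Yoneda lemma, k is precomposition with its value at the identity, and that value is f.
    have hk : (y U).map (Coll.tyHom U f).op = k := y_ext (Category.comp_id f)
    refine ⟨f, (key f).trans ?_⟩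
    rw [hk]
    refine congrArg (Γel (M := N) (r := .ty t')) (?_ : _ = Γhom (M := N) (r := .ty t') g)
    simp [k]

lemma isIso_rightHomι_app (N : Bimod S U) (P : Bimod R U) (r : Coll R) (t : T) :
    IsIso (((N.rightHomι P).app (op r)).hom.app (.ty t)) := by
  cases r with
  | ent e => exact inferInstanceAs (IsIso (𝟙 ((N.Γ.obj (P.F.obj (op (.ent e)))).obj.obj (.ty t))))
  | ty t' => exact (isIso_iff_bijective _).2 (rightHomTy_bijective N P t' t)

variable [HasFiniteProducts T]

/-! ### Calculus of transposes for Λ ⊣ Γ. -/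

section

variable (N : Bimod S U) {I I' : Inst S} {J J' : Inst U}

@[simp] lemma untranspose_transpose (g : (Λ N.F).obj I ⟶ J) :
    N.untranspose (N.transpose g) = g := Λ_ext fun _ _ => N.inj_untranspose _ _

@[simp] lemma transpose_untranspose (h : I ⟶ N.Γ.obj J) :
    N.transpose (N.untranspose h) = h := inst_ext fun _ _ => N.inj_untranspose _ _

/-- The hom bijection of `N.adj` is `transpose` up to definitional unfolding, so the general
naturality of an adjunction applies as it stands, here in the first variable and in `transpose_comp`
in the second. -/
lemma transpose_map_comp (f : I' ⟶ I) (g : (Λ N.F).obj I ⟶ J) :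
    N.transpose ((Λ N.F).map f ≫ g) = f ≫ N.transpose g :=
  N.adj.homEquiv_naturality_left f g

lemma transpose_comp (g : (Λ N.F).obj I ⟶ J) (h : J ⟶ J') :
    N.transpose (g ≫ h) = N.transpose g ≫ N.Γ.map h :=
  N.adj.homEquiv_naturality_right g h

/-- The two sides have the same transpose, by `transpose_map_comp`; `untranspose_comp_map` follows
in the same way from `transpose_comp`. -/
lemma map_comp_untranspose (f : I' ⟶ I) (h : I ⟶ N.Γ.obj J) :
    (Λ N.F).map f ≫ N.untranspose h = N.untranspose (f ≫ h) := by
  rw [← N.untranspose_transpose ((Λ N.F).map f ≫ N.untranspose h), transpose_map_comp,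
    transpose_untranspose]

lemma untranspose_comp_map (h : I ⟶ N.Γ.obj J) (g : J ⟶ J') :
    N.untranspose (h ≫ N.Γ.map g) = N.untranspose h ≫ g := by
  rw [← N.untranspose_transpose (N.untranspose h ≫ g), transpose_comp, transpose_untranspose]

end

/-! ### The bijection Φ. -/

section

variable (M : Bimod R S) (N : Bimod S U) (P : Bimod R U)

/-- The transpose of the identification of `(M ⊙ N)(t)` with `P(t)`. -/
lemma transpose_tyIso (t : T) :
    N.transpose (((M.comp N).tyIso t).hom ≫ (P.tyIso t).inv) =
      (M.tyIso t).hom ≫ rightHomTy N P t := by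
  refine inst_ext fun s x => ?_
  -- An element x of M(t) at s is, under `M.tyIso t`, a morphism t ⟶ s of the collage. On the
  -- summand of Λ_N indexed by x the identification of the composite is thus N applied to that
  -- morphism, followed by `N.tyIso t`. This is also how ι_t acts on it, by definition of the
  -- morphism attached to an element.
  have h : inj N.F x ≫ ((M.comp N).tyIso t).hom = N.F.map (M.tyHom x).op ≫ (N.tyIso t).hom := by
    rw [comp_tyIso_hom, ← Category.assoc, inj_map, ← Category.assoc]
    exact congrArg (· ≫ (N.tyIso t).hom) (inj_ΛyIso N.F (M.tyHom x))
  exact congrArg (Γel (M := N)) ((Category.assoc _ _ _).symm.trans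
    ((congrArg (· ≫ (P.tyIso t).inv) h).trans (Category.assoc _ _ _)))

lemma untranspose_tyIso (t : T) :
    N.untranspose ((M.tyIso t).hom ≫ rightHomTy N P t) =
      ((M.comp N).tyIso t).hom ≫ (P.tyIso t).inv :=
  (congrArg N.untranspose (transpose_tyIso M N P t).symm).trans
    (N.untranspose_transpose _)

variable {M N P}

/-- Being the identity on types leaves only one possible value for κ at t, the identification
computed in `transpose_tyIso`. It is here that the transposed family is seen to factor through ι at
types. -/
lemma transpose_nat_ty (κ : M.comp N ⟶ P) (t : T) :
    N.transpose (κ.nat.app (op (.ty t))) = (M.tyIso t).hom ≫ rightHomTy N P t :=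
  (congrArg N.transpose ((Iso.eq_comp_inv _).2 (κ.nat_ty t))).trans (transpose_tyIso M N P t)

/-- Naturality of κ carried across the adjunction in both variables. Here f is any morphism of the
collage, so observables are covered as well as morphisms of entities. -/
lemma transpose_naturality (κ : M.comp N ⟶ P) {r r' : Coll R} (f : r ⟶ r') :
    M.F.map f.op ≫ N.transpose (κ.nat.app (op r)) =
      N.transpose (κ.nat.app (op r')) ≫ N.Γ.map (P.F.map f.op) :=
  (N.transpose_map_comp (M.F.map f.op) (κ.nat.app (op r))).symm.trans
    ((congrArg N.transpose (κ.nat.naturality f.op)).trans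
      (N.transpose_comp (κ.nat.app (op r')) (P.F.map f.op)))

/-- The morphism into the right hom corresponding to a morphism out of a composite. -/
def toRightHom (κ : M.comp N ⟶ P) : M ⟶ N.rightHom P where
  nat :=
    { app := fun a => match a with
        | ⟨.ent e⟩ => N.transpose (κ.nat.app (op (.ent e)))
        -- The only possible choice, since the right hom is identified with y(t) by an identity.
        | ⟨.ty t⟩ => (M.tyIso t).hom
      naturality := fun ⟨a⟩ ⟨b⟩ f => by
        obtain ⟨f, rfl⟩ : ∃ f', f = Quiver.Hom.op f' := ⟨f.unop, rfl⟩
        cases b <;> cases a <;> first | exact PEmpty.elim f | skip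
        · exact transpose_naturality κ f
        -- For an observable e → t, the right hom acts as ι_t followed by Γ_N(P(f)), so the square
        -- is the transposed naturality square with its component at t factored through ι_t.
        · rename_i e t
          refine (transpose_naturality κ f).trans ?_
          exact (congrArg (· ≫ _) (transpose_nat_ty κ t)).trans (Category.assoc _ _ _)
        · exact M.tyIso_nat f }
  nat_ty _ := Category.comp_id _

/-- At entities ι is an identity; at types this is the forced factorisation `transpose_nat_ty`. It
characterises Φ as the adjunction bijection and also yields one of the two inverse laws. -/
lemma toRightHom_ι (κ : M.comp N ⟶ P) (r : Coll R) :
    (toRightHom κ).nat.app (op r) ≫ (N.rightHomι P).app (op r) =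
      N.transpose (κ.nat.app (op r)) := by
  cases r with
  | ent e => exact Category.comp_id _
  | ty t => exact (transpose_nat_ty κ t).symm

/-- The morphism out of a composite corresponding to a morphism into the right hom. -/
def ofRightHom (h : M ⟶ N.rightHom P) : M.comp N ⟶ P where
  nat :=
    { app := fun r => N.untranspose (h.nat.app r ≫ (N.rightHomι P).app r)
      naturality := fun r r' f =>
        (N.map_comp_untranspose (M.F.map f) _).trans
          ((congrArg N.untranspose ((h.nat ≫ N.rightHomι P).naturality f)).trans
            (N.untranspose_comp_map _ (P.F.map f))) }
  nat_ty t := by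
    -- The identification of N ▷ P at t is an identity, so the type condition determines h there;
    -- untransposing it after ι_t gives the identification of (M ⊙ N)(t) with P(t).
    have h₁ : h.nat.app (op (.ty t)) = (M.tyIso t).hom :=
      (Category.comp_id _).symm.trans (h.nat_ty t)
    have h₂ : N.untranspose (h.nat.app (op (.ty t)) ≫ (N.rightHomι P).app (op (.ty t))) =
        ((M.comp N).tyIso t).hom ≫ (P.tyIso t).inv :=
      (congrArg (fun k => N.untranspose (k ≫ rightHomTy N P t)) h₁).trans
        (untranspose_tyIso M N P t)
    exact (Iso.eq_comp_inv _).1 h₂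

variable (M N P) in
/-- Morphisms out of a composite of bimodules correspond to morphisms into the right hom. -/
def rightHomEquiv : (M.comp N ⟶ P) ≃ (M ⟶ N.rightHom P) where
  toFun := toRightHom
  invFun := ofRightHom
  left_inv κ := hom_ext fun r =>
    (congrArg N.untranspose (toRightHom_ι κ r)).trans (N.untranspose_transpose _)
  -- Entities suffice, and there ι is an identity, so only the adjunction is involved.
  right_inv _ := hom_ext_ent fun _ =>
    (N.transpose_untranspose _).trans (Category.comp_id _)

/-- Untransposing is evaluation: x yields, through h and ι, a morphism out of N(s), which is applied
to z. For h the identity this describes ε on generators. -/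
lemma ofRightHom_tmul (h : M ⟶ N.rightHom P) {r : Coll R} {s : Coll S} {u : Coll U}
    (x : (M.F.obj (op r)).obj.obj s) (z : (N.F.obj (op s)).obj.obj u) :
    ap ((ofRightHom h).nat.app (op r)) (M.tmul N x z) =
      ap (Γhom (ap ((N.rightHomι P).app (op r)) (ap (h.nat.app (op r)) x))) z :=
  congrArg (fun k => ap k z)
    (N.inj_untranspose (h.nat.app (op r) ≫ (N.rightHomι P).app (op r)) x)

end

/-- It is enough to compare at entities, where both sides send x to the same composite: ψ, then the
coprojection of Λ_N at θ(x), then κ, then ρ. Only the compatibility of `compMap` with coprojections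
and associativity are needed. -/
lemma toRightHom_naturality {M M' : Bimod R S} {N N' : Bimod S U} {P P' : Bimod R U}
    (θ : M' ⟶ M) (ψ : N' ⟶ N) (κ : M.comp N ⟶ P) (ρ : P ⟶ P') :
    toRightHom (compMap θ ψ ≫ κ ≫ ρ) = θ ≫ toRightHom κ ≫ rightHomMap ψ ρ := by
  refine hom_ext_ent fun e => inst_ext fun s x => ?_
  change Γel (M := N') (inj N'.F x ≫ (compMapNat θ ψ).app (op (.ent e)) ≫
      κ.nat.app (op (.ent e)) ≫ ρ.nat.app (op (.ent e))) =
    Γel (M := N') (ψ.nat.app (op s) ≫ (inj N.F (ap (θ.nat.app (op (.ent e))) x) ≫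
      κ.nat.app (op (.ent e))) ≫ ρ.nat.app (op (.ent e)))
  have h : inj N'.F x ≫ (compMapNat θ ψ).app (op (.ent e)) =
      ψ.nat.app (op s) ≫ inj N.F (ap (θ.nat.app (op (.ent e))) x) :=
    inst_ext fun u z => compMapNat_tmul θ ψ x z
  refine congrArg (Γel (M := N')) ((Category.assoc _ _ _).symm.trans ((congrArg
    (· ≫ κ.nat.app (op (.ent e)) ≫ ρ.nat.app (op (.ent e))) h).trans ?_))
  exact (Category.assoc _ _ _).trans
    (congrArg (ψ.nat.app (op s) ≫ ·) (Category.assoc _ _ _).symm)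

end Bimod

/-! ### 2-cells with identity right side as morphisms of bimodules. -/

namespace Cell

section

variable {F : Q ⟶ R} {M : Bimod Q S} {P : Bimod R S}

/-- A 2-cell whose right side is an identity, as a morphism into a restriction. -/
def toRestrLeft (θ : Cell F (𝟙 S) M P) : M ⟶ Bimod.restrLeft F P where
  nat :=
    { app := fun r => θ.nat.app r ≫
        -- The functor induced on collages by the identity mapping is the identity only after a case
        -- distinction on objects, so `Coll.mapId` is needed to remove it.
        ObjectProperty.homMk (Functor.whiskerRight (Coll.mapId S).hom _)
      naturality := fun r r' f => inst_ext fun s x => by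
        change act ((Coll.mapId S).hom.app s) (θ.fn (M.bmap f.unop x)) =
          P.bmap ((Coll.map F).map f.unop) (act ((Coll.mapId S).hom.app s) (θ.fn x))
        rw [fn_bmap, Bimod.bmap_act] }
  nat_ty t := inst_ext fun s x => by
    change P.tyHom (t := t) (act ((Coll.mapId S).hom.app s) (θ.fn x)) = M.tyHom x
    refine (P.tyHom_act (t := t) (θ.fn x) _).trans ?_
    refine (congrArg (· ≫ (Coll.mapId S).hom.app s) (tyHom_fn θ x)).trans ?_
    exact ((Coll.mapId S).hom.naturality (M.tyHom x)).trans (Category.id_comp _)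

/-- A morphism into a restriction, as a 2-cell whose right side is an identity. -/
def ofRestrLeft (α : M ⟶ Bimod.restrLeft F P) : Cell F (𝟙 S) M P where
  nat := α.nat ≫ Functor.whiskerLeft (Bimod.restrLeft F P).F (Δid S)
  nat_ty t := inst_ext fun s x => (nat_ty_iff _ t x).2 (by
    change P.tyHom (t := t) (act ((Coll.mapId S).inv.app s) (ap (α.nat.app (op (.ty t))) x)) =
      (Coll.map (𝟙 S)).map (M.tyHom x)
    refine (P.tyHom_act (t := t) (ap (α.nat.app (op (.ty t))) x) _).trans ?_
    refine (congrArg (· ≫ (Coll.mapId S).inv.app s) (Bimod.tyHom_nat α x)).trans ?_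
    exact ((Coll.mapId S).inv.naturality (M.tyHom x)).trans (Category.id_comp _))

variable {r : Coll Q} {s : Coll S}

/-- The correction by `Coll.mapId` is an identity on entities and on types alike, so elements do not
change. Heterogeneous equality is needed only because the collage object over which the element lies
is s on one side and its image under the identity mapping on the other. -/
lemma toRestrLeft_heq (θ : Cell F (𝟙 S) M P) (x : (M.F.obj (op r)).obj.obj s) :
    HEq (ap (θ.toRestrLeft.nat.app (op r)) x) (θ.fn x) := by
  have key : ap (θ.toRestrLeft.nat.app (op r)) x = act ((Coll.mapId S).hom.app s) (θ.fn x) := rfl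
  rw [key]
  cases s <;> exact heq_of_eq (act_id _)

lemma ofRestrLeft_heq (α : M ⟶ Bimod.restrLeft F P) (x : (M.F.obj (op r)).obj.obj s) :
    HEq ((ofRestrLeft α).fn x) (ap (α.nat.app (op r)) x) := by
  have key : (ofRestrLeft α).fn x =
    act ((Coll.mapId S).inv.app s) (ap (α.nat.app (op r)) x) := rfl
  rw [key]
  cases s <;> exact heq_of_eq (act_id _)

/-- 2-cells whose right side is an identity correspond to morphisms into a restriction. -/
def restrLeftEquiv : Cell F (𝟙 S) M P ≃ (M ⟶ Bimod.restrLeft F P) where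
  toFun := toRestrLeft
  invFun := ofRestrLeft
  left_inv θ := ext_fn fun _ _ x =>
    eq_of_heq ((ofRestrLeft_heq θ.toRestrLeft x).trans (toRestrLeft_heq θ x))
  right_inv α := Bimod.hom_ext fun _ => inst_ext fun _ x =>
    eq_of_heq ((toRestrLeft_heq (ofRestrLeft α) x).trans (ofRestrLeft_heq α x))

end

/-! ### The universal property of ε. -/

variable [HasFiniteProducts T] {F : Q ⟶ R} {M : Bimod Q S} {N : Bimod S U} {P : Bimod R U}

/-- The value on elements of the composite of a 2-cell with the counit of the right hom. -/
lemma hComp_vComp_ofRightHom_heq (θ : Cell F (𝟙 S) M (N.rightHom P)) {r : Coll Q} {s : Coll S}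
    {u : Coll U} (x : (M.F.obj (op r)).obj.obj s) (z : (N.F.obj (op s)).obj.obj u) :
    HEq ((vComp (hComp θ (ofHom (𝟙 N)))
        (ofHom (Bimod.ofRightHom (𝟙 (N.rightHom P))))).fn (M.tmul N x z))
      (ap (Bimod.Γhom (ap ((N.rightHomι P).app (op ((Coll.map F).obj r)))
        (ap (θ.toRestrLeft.nat.app (op r)) x))) z) := by
  refine (vComp_fn _ _ _).trans ((ofHom_fn _ _).trans ?_)
  -- The horizontal composite sends x ⊗ z to θ(x) ⊗ z up to identity vertical sides; ε is then
  -- evaluated there by `ofRightHom_tmul`.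
  refine (ap_nat_heq (Bimod.ofRightHom (𝟙 (N.rightHom P))) rfl (Coll.mapId_obj u)
    ((hComp_heq θ _ x z).trans (tmul_heq _ N rfl (Coll.mapId_obj s) (Coll.mapId_obj u)
      (toRestrLeft_heq θ x).symm (vId_fn N z)))).trans ?_
  exact heq_of_eq (Bimod.ofRightHom_tmul (𝟙 (N.rightHom P)) _ z)

/-- Transposing and then evaluating at x and z returns the value on x ⊗ z by definition, so only the
passage to the restriction has to be accounted for. -/
lemma fn_tmul_heq (θ : Cell F (𝟙 U) (M.comp N) P) {r : Coll Q} {s : Coll S} {u : Coll U}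
    (x : (M.F.obj (op r)).obj.obj s) (z : (N.F.obj (op s)).obj.obj u) :
    HEq (θ.fn (M.tmul N x z)) (ap (Bimod.Γhom
      (ap (N.transpose (θ.toRestrLeft.nat.app (op r))) x)) z) :=
  (toRestrLeft_heq θ (M.tmul N x z)).symm

/-- Both conditions say that θ', followed by ι, is the transpose of θ. On the left this is seen by
evaluating on the generators x ⊗ z; on the right by `toRightHom_ι` for the bimodule restricted along
F. The equation for θ' is thereby solved explicitly. -/
lemma hComp_vComp_ofRightHom_eq_iff (θ' : Cell F (𝟙 S) M (N.rightHom P))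
    (θ : Cell F (𝟙 U) (M.comp N) P) :
    HEq (vComp (hComp θ' (ofHom (𝟙 N))) (ofHom (Bimod.ofRightHom (𝟙 (N.rightHom P))))) θ ↔
      θ'.toRestrLeft = Bimod.toRightHom θ.toRestrLeft ≫ Bimod.rightHomRestrLeft F N P := by
  have hι (r : Coll Q) : (Bimod.toRightHom θ.toRestrLeft ≫
      Bimod.rightHomRestrLeft F N P).nat.app (op r) ≫
        (N.rightHomι P).app (op ((Coll.map F).obj r)) =
      N.transpose (θ.toRestrLeft.nat.app (op r)) :=
    (Category.assoc _ _ _).trans ((congrArg _ (Bimod.rightHomRestrLeft_ι F N P r)).trans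
      (Bimod.toRightHom_ι θ.toRestrLeft r))
  constructor
  · intro h
    -- F sends entities to entities, where ι is an identity and can be removed from `h₁`; the
    -- components at types are forced.
    refine Bimod.hom_ext_ent fun e => ?_
    have h₁ : θ'.toRestrLeft.nat.app (op (.ent e)) ≫
        (N.rightHomι P).app (op ((Coll.map F).obj (.ent e))) =
        N.transpose (θ.toRestrLeft.nat.app (op (.ent e))) := by
      refine inst_ext fun s x => inst_ext (S := U) fun u z => eq_of_heq ?_
      refine (hComp_vComp_ofRightHom_heq θ' x z).symm.trans (HEq.trans ?_ (fn_tmul_heq θ x z))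
      exact heq_of_eq (congrArg (fun k : Cell F (𝟙 U) (M.comp N) P => k.fn (M.tmul N x z))
        (eq_of_heq h))
    exact (Category.comp_id _).symm.trans ((h₁.trans (hι (.ent e)).symm).trans (Category.comp_id _))
  · intro h
    refine heq_of_tmul rfl rfl fun r s u x z => ?_
    refine (hComp_vComp_ofRightHom_heq θ' x z).trans (HEq.trans ?_ (fn_tmul_heq θ x z).symm)
    rw [h, ← hι]
    rfl

/-- The condition on θ' prescribes its image under the bijection `restrLeftEquiv`, so exactly one θ'
satisfies it. -/
lemma existsUnique_hComp_vComp_ofRightHom (θ : Cell F (𝟙 U) (M.comp N) P) :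
    ∃! θ' : Cell F (𝟙 S) M (N.rightHom P),
      HEq (vComp (hComp θ' (ofHom (𝟙 N))) (ofHom (Bimod.ofRightHom (𝟙 (N.rightHom P))))) θ := by
  simp only [hComp_vComp_ofRightHom_eq_iff]
  exact restrLeftEquiv.bijective.existsUnique _

end Cell

lemma isRightHom_rightHom [HasFiniteProducts T] (N : Bimod S U) (P : Bimod R U) :
    (Data T).IsRightHom N P (N.rightHom P)
      (Cell.ofHom (Bimod.ofRightHom (𝟙 (N.rightHom P)))) :=
  fun _ _ θ => Cell.existsUnique_hComp_vComp_ofRightHom θ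

end AlgData

end

theorem mainTheorem7 {T : Type u} [SmallCategory T] [HasFiniteProducts T] :
    (Data T).IsRightClosed ∧
    (∀ {R S U : Schema T} (N : Bimod S U) (P : Bimod R U),
      (Coll.inE R).op ⋙ (N.rightHom P).F = (Coll.inE R).op ⋙ P.F ⋙ N.Γ ∧
      (∀ e : R.Ent, (N.rightHomι P).app (op (.ent e)) = 𝟙 (N.Γ.obj (P.F.obj (op (.ent e))))) ∧
      ∀ (r : Coll R) (t : T), IsIso (((N.rightHomι P).app (op r)).hom.app (.ty t))) ∧
    ∃ Φ : ∀ {R S U : Schema T} (M : Bimod R S) (N : Bimod S U) (P : Bimod R U),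
        (M.comp N ⟶ P) ≃ (M ⟶ N.rightHom P),
      (∀ {R S U : Schema T} (M : Bimod R S) (N : Bimod S U) (P : Bimod R U) (κ : M.comp N ⟶ P)
        (r : Coll R), (Φ M N P κ).nat.app (op r) ≫ (N.rightHomι P).app (op r) =
          N.adj.homEquiv (M.F.obj (op r)) (P.F.obj (op r)) (κ.nat.app (op r))) ∧
      (∀ {R S U : Schema T} {M M' : Bimod R S} {N N' : Bimod S U} {P P' : Bimod R U}
        (θ : M' ⟶ M) (ψ : N' ⟶ N) (κ : M.comp N ⟶ P) (ρ : P ⟶ P'),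
        Φ M' N' P' (Bimod.compMap θ ψ ≫ κ ≫ ρ) = θ ≫ Φ M N P κ ≫ Bimod.rightHomMap ψ ρ) ∧
      ∀ {R S U : Schema T} (N : Bimod S U) (P : Bimod R U),
        (Data T).IsRightHom N P (N.rightHom P)
          (Cell.ofHom ((Φ (N.rightHom P) N P).symm (𝟙 (N.rightHom P)))) := by
  refine ⟨fun N P => ⟨_, _, isRightHom_rightHom N P⟩, fun N P => ⟨rfl, fun _ => rfl,
    N.isIso_rightHomι_app P⟩, fun M N P => Bimod.rightHomEquiv M N P, ?_, ?_, ?_⟩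
  -- The adjunction's `homEquiv` unfolds to `transpose`, so this is the characterisation of Φ
  -- through ι.
  · exact fun M N P κ r => Bimod.toRightHom_ι κ r
  · exact fun θ ψ κ ρ => Bimod.toRightHom_naturality θ ψ κ ρ
  -- The inverse of Φ is `ofRightHom` by definition, so the 2-cell named here is the ε of the
  -- universal property.
  · exact fun N P => isRightHom_rightHom N P
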